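/- Let $n\ge 2$. Let $Q_n$ be the $n$-dimensional hypercube, i.e. the graph whose vertices are all $n$-bit strings, two vertices being adjacent if and only if they differ in exactly one bit, and let $K(Q_n)$ be the complete graph on the vertex set $V(Q_n)$ (so $|V(Q_n)|=2^n$). Let $M$ be a matching in $K(Q_n)$, i.e. a set of pairwise non-adjacent edges of $K(Q_n)$ (which need not be edges of $Q_n$), and let $\bigcup M$ denote the set of vertices incident with an edge of $M$. If $$\Bigl|\bigcup M\Bigr| < \frac{n^2}{6}+\frac{n}{2}+1,$$ then there is a set $S\subseteq E(Q_n)$ such that $M\cup S$ is the edge set of a cycle in $K(Q_n)$ of length at least $\frac34\,|V(Q_n)| = \frac34\cdot 2^n$. -/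

import Mathlib

/-- The `n`-dimensional hypercube `Q_n`: the vertices are the `n`-bit strings, and two of them are
adjacent if and only if they differ in exactly one bit. -/
def hypercube (n : ℕ) : SimpleGraph (Fin n → Bool) where
  Adj u v := hammingDist u v = 1
  symm := ⟨fun u v h => by rw [hammingDist_comm]; exact h⟩
  loopless := ⟨fun u h => by simp at h⟩

/-- The complete graph `K(Q_n)` on the vertex set of the hypercube `Q_n`. -/
abbrev hypercubeComplete (n : ℕ) : SimpleGraph (Fin n → Bool) := ⊤

/-!
The proof is an induction on `n` that splits `Q_{n+1}` into two facets, copies of `Q_n`, along a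
direction `d`. Since the matching may use edges outside the cube, the ends of matching edges that
cross between the facets can be re-paired inside the facets. If the number of crossing edges is
even and positive, their ends on one side are paired arbitrarily and a long cycle is found there;
deleting the pairing from this cycle leaves paths, which say how to pair the ends on the other side
so that the two cycles merge into one (`IsCycleGraph.splice`, `IsDoubling.extends_of_pairing`). An
odd number of crossing edges is made even by adding a cube edge in direction `d`, and if no edge
crosses, an edge of the first cycle is replaced by a detour through the other facet. The lengths add
up, so the fraction `3/4` is preserved.

It remains to find a direction in which neither facet contains too many matched vertices. Comparing
all matched vertices with the vertex `w` of majority values, at most one of them has distance `0`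
from `w` and at most `n + 1` have distance `1`, so the minority counts over all directions have a
large sum (`exists_majority`). This lets the admissible number of matched vertices grow with `n`
(`ExtendsUpTo.step`): it may be `4, 4, 6, 8, 12` in dimensions `2` to `6`,
where dimensions `3`, `4` and `6` need a refined choice of the direction or of the added edge, and
`(j + 1) * (6 * j + 2 * s)` in dimension `6 * j + s` with `1 ≤ j` and `s < 6`, which is at least
the bound of the theorem. All these numbers are even, so rounding up to an even number, as
needed for an odd number of crossing edges, costs nothing.
-/

open SimpleGraph

/-! ### Matchings and cycles as graphs -/

/-- A graph all of whose vertices have at most one neighbour, that is, a matching together with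
isolated vertices. Its `support` is the set of matched vertices. -/
def IsMatchingGraph {V : Type*} (M : SimpleGraph V) : Prop :=
  ∀ ⦃a b c⦄, M.Adj a b → M.Adj a c → b = c

/-- A graph that consists of a single cycle on its `support` and of isolated vertices. -/
structure IsCycleGraph {V : Type*} (C : SimpleGraph V) : Prop where
  nonempty : C.support.Nonempty
  two_nbrs : ∀ v ∈ C.support, ∃ a b, a ≠ b ∧ ∀ x, C.Adj v x ↔ x = a ∨ x = b
  reachable : ∀ u ∈ C.support, ∀ v ∈ C.support, C.Reachable u v

/-- The matching `M` extends, by edges of `G`, to a cycle through at least three quarters of the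
vertices. -/
def ExtendsToLongCycle {V : Type*} (G M : SimpleGraph V) : Prop :=
  ∃ C : SimpleGraph V, IsCycleGraph C ∧ M ≤ C ∧ C ≤ M ⊔ G ∧
    3 * Nat.card V ≤ 4 * C.support.ncard

/-- Every matching whose set of matched vertices is exactly `T` extends to a long cycle. -/
def IsExtendableSet {V : Type*} (G : SimpleGraph V) (T : Set V) : Prop :=
  ∀ M : SimpleGraph V, IsMatchingGraph M → M.support = T → ExtendsToLongCycle G M

section Matchings
variable {V : Type*}

theorem IsMatchingGraph.sup {M N : SimpleGraph V} (hM : IsMatchingGraph M)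
    (hN : IsMatchingGraph N) (hd : Disjoint M.support N.support) : IsMatchingGraph (M ⊔ N) := by
  intro a b c hb hc
  rw [Set.disjoint_left] at hd
  rcases hb with hb | hb <;> rcases hc with hc | hc
  · exact hM hb hc
  · exact absurd hc.mem_support_left (hd hb.mem_support_left)
  · exact absurd hb.mem_support_left (hd hc.mem_support_left)
  · exact hN hb hc

theorem isMatchingGraph_edge (a b : V) : IsMatchingGraph (edge a b) := by
  intro x y z hy hz
  rw [edge_adj] at hy hz
  grind

theorem support_sup (M N : SimpleGraph V) : (M ⊔ N).support = M.support ∪ N.support := by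
  ext v
  simp only [mem_support, sup_adj, Set.mem_union, exists_or]

theorem support_edge {a b : V} (h : a ≠ b) : (edge a b).support = {a, b} := by
  ext v
  simp only [mem_support, edge_adj, Set.mem_insert_iff, Set.mem_singleton_iff]
  constructor
  · rintro ⟨w, hw⟩
    tauto
  · rintro (rfl | rfl)
    · exact ⟨b, .inl ⟨rfl, rfl⟩, h⟩
    · exact ⟨a, .inr ⟨rfl, rfl⟩, h.symm⟩

theorem IsMatchingGraph.even_ncard_support [Finite V] {M : SimpleGraph V}
    (hM : IsMatchingGraph M) : Even M.support.ncard := by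
  classical
  have := Fintype.ofFinite V
  have h : M.support = ↑(Finset.univ.filter fun v => Odd (M.degree v)) := by
    ext v
    simp only [Finset.coe_filter, Finset.mem_univ, true_and, Set.mem_ofPred_eq, mem_support]
    constructor
    · rintro ⟨w, hw⟩
      have : M.neighborFinset v = {w} := by
        ext x
        simp only [mem_neighborFinset, Finset.mem_singleton]
        exact ⟨fun h => hM h hw, fun h => h ▸ hw⟩
      rw [← card_neighborFinset_eq_degree, this]
      simp
    · intro h
      exact (M.degree_pos_iff_exists_adj v).1 h.pos
  rw [h, Set.ncard_coe_finset]
  exact M.even_card_odd_degree_vertices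

/-- A finite set of even size is the set of matched vertices of some matching. -/
theorem exists_isMatchingGraph_support_eq [Finite V] (U : Set V) (hU : Even U.ncard) :
    ∃ N : SimpleGraph V, IsMatchingGraph N ∧ N.support = U := by
  obtain ⟨k, hk⟩ := hU
  have hc : Nat.card U = Nat.card (Fin k × Bool) := by
    rw [Nat.card_coe_set_eq, hk]; simp [mul_two]
  obtain ⟨e⟩ : Nonempty (U ≃ Fin k × Bool) := Finite.card_eq.1 hc
  refine ⟨{ Adj := fun a b => ∃ (ha : a ∈ U) (hb : b ∈ U),
              (e ⟨b, hb⟩).1 = (e ⟨a, ha⟩).1 ∧ (e ⟨b, hb⟩).2 = !(e ⟨a, ha⟩).2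
            symm := ⟨?_⟩, loopless := ⟨?_⟩ }, ?_, ?_⟩
  · rintro a b ⟨ha, hb, h1, h2⟩
    exact ⟨hb, ha, h1.symm, by simp [h2]⟩
  · rintro a ⟨ha, hb, h1, h2⟩
    simp at h2
  · rintro a b c ⟨ha, hb, h1, h2⟩ ⟨ha', hc, h3, h4⟩
    have : e ⟨b, hb⟩ = e ⟨c, hc⟩ := Prod.ext (h1.trans h3.symm) (h2.trans h4.symm)
    simpa using this
  · ext a
    simp only [mem_support]
    constructor
    · rintro ⟨b, ha, _⟩
      exact ha
    · intro ha
      let b := e.symm ((e ⟨a, ha⟩).1, !(e ⟨a, ha⟩).2)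
      exact ⟨b, ha, b.2, by simp [b], by simp [b]⟩

end Matchings

/-! ### Paths left by deleting a matching from a cycle -/

section Pairing
variable {V : Type*} {C N : SimpleGraph V}

/-- Deleting from a cycle some of its edges leaves no component without an end of a deleted
edge. -/
theorem IsCycleGraph.exists_reachable_sdiff (hC : IsCycleGraph C) (hle : N ≤ C)
    (hne : N.support.Nonempty) {v : V} (hv : v ∈ C.support) :
    ∃ u ∈ N.support, (C \ N).Reachable v u := by
  obtain ⟨n, hn⟩ := hne
  obtain ⟨p⟩ := hC.reachable v hv n (support_mono hle hn)
  induction p with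
  | nil => exact ⟨_, hn, .refl _⟩
  | @cons a b c hab p ih =>
    by_cases ha : a ∈ N.support
    · exact ⟨a, ha, .refl _⟩
    · obtain ⟨u, hu, hr⟩ := ih hab.mem_support_right hn
      refine ⟨u, hu, .trans (Adj.reachable ?_) hr⟩
      exact ⟨hab, fun h => ha h.mem_support_left⟩

/-- Deleting a matching from a cycle leaves paths: the component of an end `u` of a deleted edge
contains exactly one further end of deleted edges. In a component with `c` vertices, `t` of which
are such ends, the degree sum is `2c - t`; connectedness bounds it below by `2(c - 1)`, and it is
even, so `t = 2`. -/
theorem IsCycleGraph.existsUnique_reachable_sdiff [Finite V] (hC : IsCycleGraph C)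
    (hN : IsMatchingGraph N) (hle : N ≤ C) {u : V} (hu : u ∈ N.support) :
    ∃! v, v ≠ u ∧ v ∈ N.support ∧ (C \ N).Reachable u v := by
  classical
  have := Fintype.ofFinite V
  set D := C \ N with hD
  let c := D.connectedComponentMk u
  let H := c.toSimpleGraph
  have hmem : ∀ v, v ∈ c ↔ D.Reachable u v := fun v =>
    ConnectedComponent.eq.trans (reachable_comm)
  have hsupp : ∀ v ∈ c, v ∈ C.support := by
    intro v hv
    by_cases h : v = u
    · exact h ▸ support_mono hle hu
    · obtain ⟨p⟩ := ((hmem v).1 hv).symm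
      cases p with
      | nil => exact absurd rfl h
      | cons hw _ => exact hw.1.mem_support_left
  have hdeg : ∀ v : c, H.degree v + (if (v : V) ∈ N.support then 1 else 0) = 2 := by
    intro v
    have h1 : (H.neighborFinset v).map (.subtype _) = D.neighborFinset v := by
      ext w
      simp only [Finset.mem_map, mem_neighborFinset, Function.Embedding.subtype_apply,
        Subtype.exists, exists_and_right, exists_eq_right]
      constructor
      · rintro ⟨hw, h⟩
        exact h
      · intro h
        exact ⟨(c.mem_supp_congr_adj h).1 v.2, h⟩
    have h2 : H.degree v = (D.neighborFinset v).card := by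
      rw [← h1, Finset.card_map, card_neighborFinset_eq_degree]
    obtain ⟨a, b, hab, hx⟩ := hC.two_nbrs v (hsupp v v.2)
    rw [h2]
    split_ifs with hv
    · obtain ⟨w, hw⟩ := hv
      have hwab := (hx w).1 (hle hw)
      have : D.neighborFinset v = {a, b} \ {w} := by
        ext x
        simp only [mem_neighborFinset, hD, sdiff_adj, hx, Finset.mem_sdiff, Finset.mem_insert,
          Finset.mem_singleton]
        refine and_congr_right fun _ => not_congr ⟨fun h => hN h hw, fun h => h ▸ hw⟩
      rw [this, Finset.card_sdiff_of_subset (by simpa using hwab), Finset.card_pair hab]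
      simp
    · have : D.neighborFinset v = {a, b} := by
        ext x
        simp only [mem_neighborFinset, hD, sdiff_adj, hx, Finset.mem_insert,
          Finset.mem_singleton]
        refine and_iff_left fun h => hv h.mem_support_left
      rw [this, Finset.card_pair hab]
  -- the vertices of the component that are ends of deleted edges
  let A : Finset c := Finset.univ.filter fun v => (v : V) ∈ N.support
  have hsum : 2 * H.edgeFinset.card + A.card = 2 * Fintype.card c := by
    rw [← H.sum_degrees_eq_twice_card_edges, Finset.card_filter, ← Finset.sum_add_distrib,
      Finset.sum_congr rfl fun v _ => hdeg v]
    simp [mul_comm]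
  have hconn : Fintype.card c ≤ H.edgeFinset.card + 1 := by
    have := c.connected_toSimpleGraph.card_vert_le_card_edgeSet_add_one
    rwa [Nat.card_eq_fintype_card, Nat.card_eq_fintype_card, ← edgeFinset_card] at this
  have huA : (⟨u, rfl⟩ : c) ∈ A := by simpa [A] using hu
  have hpos : 0 < A.card := Finset.card_pos.2 ⟨_, huA⟩
  have hA : A.card = 2 := by lia
  have hA1 : (A.erase ⟨u, rfl⟩).card = 1 := by rw [Finset.card_erase_of_mem huA, hA]
  obtain ⟨⟨v, hvc⟩, hv⟩ := Finset.card_eq_one.1 hA1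
  have hiff : ∀ w (hw : w ∈ c), (w ≠ u ∧ w ∈ N.support) ↔ w = v := by
    intro w hw
    have := Finset.ext_iff.1 hv ⟨w, hw⟩
    simpa [A, Subtype.ext_iff] using this
  refine ⟨v, ?_, ?_⟩
  · have := (hiff v hvc).2 rfl
    exact ⟨this.1, this.2, (hmem v).1 hvc⟩
  · rintro w ⟨h1, h2, h3⟩
    exact (hiff w ((hmem w).2 h3)).1 ⟨h1, h2⟩

end Pairing

/-! ### Splicing two cycles -/

section Splicing
variable {W : Type*} {C C₀ C₁ N N₀ N₁ B : SimpleGraph W}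

/-- A vertex of a cycle keeps two neighbours if its edge in `N`, if any, is exchanged for an edge of
`B` that leaves the cycle. -/
theorem IsCycleGraph.two_nbrs_exchange (hC : IsCycleGraph C) (hN : IsMatchingGraph N)
    (hle : N ≤ C) (hB : IsMatchingGraph B) {v : W} (hv : v ∈ C.support)
    (hBN : ∀ w, B.Adj v w → v ∈ N.support ∧ w ∉ C.support)
    (hNB : v ∈ N.support → ∃ w, B.Adj v w) :
    ∃ a b, a ≠ b ∧ ∀ x, (C \ N ⊔ B).Adj v x ↔ x = a ∨ x = b := by
  obtain ⟨a, b, hab, hx⟩ := hC.two_nbrs v hv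
  by_cases h : v ∈ N.support
  · obtain ⟨w, hw⟩ := hNB h
    obtain ⟨y, hy⟩ := h
    have hwC : ¬ C.Adj v w := fun h => (hBN w hw).2 h.mem_support_right
    have key : ∀ z, C.Adj v z → z ≠ y → (∀ x, C.Adj v x ↔ x = y ∨ x = z) →
        ∃ a b, a ≠ b ∧ ∀ x, (C \ N ⊔ B).Adj v x ↔ x = a ∨ x = b := by
      intro z hz hzy hyz
      refine ⟨z, w, fun h => hwC (h ▸ hz), fun x => ?_⟩
      simp only [sup_adj, sdiff_adj]
      have h1 : N.Adj v x ↔ x = y := ⟨fun h => hN h hy, fun h => h ▸ hy⟩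
      have h2 : B.Adj v x ↔ x = w := ⟨fun h => hB h hw, fun h => h ▸ hw⟩
      rw [hyz, h1, h2]
      grind
    rcases (hx y).1 (hle hy) with rfl | rfl
    · exact key b ((hx b).2 (.inr rfl)) hab.symm hx
    · exact key a ((hx a).2 (.inl rfl)) hab fun x => (hx x).trans or_comm
  · refine ⟨a, b, hab, fun x => ?_⟩
    rw [← hx x]
    simp only [sup_adj, sdiff_adj]
    constructor
    · rintro (h' | h')
      · exact h'.1
      · exact absurd (hBN x h').1 h
    · exact fun h' => .inl ⟨h', fun h'' => h h''.mem_support_left⟩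

/-- Two disjoint cycles are spliced into one: remove the matching `N₀` from the first and `N₁`
from the second, and join the ends of the removed edges by the matching `B`. The result is a
single cycle as soon as each edge of `N₁` joins the partners of the two ends of one of the paths
that `N₀` leaves of the first cycle: these paths then replace the edges of `N₁`. -/
theorem IsCycleGraph.splice (h₀ : IsCycleGraph C₀) (h₁ : IsCycleGraph C₁)
    (hd : Disjoint C₀.support C₁.support)
    (hN₀ : IsMatchingGraph N₀) (hle₀ : N₀ ≤ C₀) (hN₁ : IsMatchingGraph N₁) (hle₁ : N₁ ≤ C₁)
    (hB : IsMatchingGraph B)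
    (hBN : ∀ u w, B.Adj u w →
      (u ∈ N₀.support ∧ w ∈ N₁.support) ∨ (u ∈ N₁.support ∧ w ∈ N₀.support))
    (hB₀ : ∀ u ∈ N₀.support, ∃ w, B.Adj u w) (hB₁ : ∀ w ∈ N₁.support, ∃ u, B.Adj w u)
    (hne : N₀.support.Nonempty)
    (hpath : ∀ w w' u u', N₁.Adj w w' → B.Adj w u → B.Adj w' u' → (C₀ \ N₀).Reachable u u') :
    IsCycleGraph (C₀ \ N₀ ⊔ C₁ \ N₁ ⊔ B) ∧
      (C₀ \ N₀ ⊔ C₁ \ N₁ ⊔ B).support = C₀.support ∪ C₁.support := by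
  set F := C₀ \ N₀ ⊔ C₁ \ N₁ ⊔ B with hF
  have hs₀ := support_mono hle₀
  have hs₁ := support_mono hle₁
  rw [Set.disjoint_left] at hd
  have hsub : ∀ v ∈ F.support, v ∈ C₀.support ∨ v ∈ C₁.support := by
    rintro v ⟨w, (h | h) | h⟩
    · exact .inl h.1.mem_support_left
    · exact .inr h.1.mem_support_left
    · rcases hBN _ _ h with h | h
      · exact .inl (hs₀ h.1)
      · exact .inr (hs₁ h.1)
  have htwo : ∀ v, v ∈ C₀.support ∨ v ∈ C₁.support →
      ∃ a b, a ≠ b ∧ ∀ x, F.Adj v x ↔ x = a ∨ x = b := by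
    rintro v (hv | hv)
    · obtain ⟨a, b, hab, hx⟩ := h₀.two_nbrs_exchange hN₀ hle₀ hB hv
        (fun w hw => by
          rcases hBN _ _ hw with h | h
          · exact ⟨h.1, fun h' => hd h' (hs₁ h.2)⟩
          · exact absurd (hs₁ h.1) (hd hv)) (hB₀ v)
      refine ⟨a, b, hab, fun x => ?_⟩
      rw [← hx x]
      have : ¬ C₁.Adj v x := fun h => hd hv h.mem_support_left
      simp only [hF, sup_adj, sdiff_adj]
      tauto
    · obtain ⟨a, b, hab, hx⟩ := h₁.two_nbrs_exchange hN₁ hle₁ hB hv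
        (fun w hw => by
          rcases hBN _ _ hw with h | h
          · exact absurd hv (hd (hs₀ h.1))
          · exact ⟨h.1, fun h' => hd (hs₀ h.2) h'⟩) (hB₁ v)
      refine ⟨a, b, hab, fun x => ?_⟩
      rw [← hx x]
      have : ¬ C₀.Adj v x := fun h => hd h.mem_support_left hv
      simp only [hF, sup_adj, sdiff_adj]
      tauto
  have hsupp : F.support = C₀.support ∪ C₁.support := by
    ext v
    refine ⟨hsub v, fun hv => ?_⟩
    obtain ⟨a, b, -, hx⟩ := htwo v hv
    exact ⟨a, (hx a).2 (.inl rfl)⟩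
  refine ⟨⟨?_, fun v hv => htwo v (hsub v hv), ?_⟩, hsupp⟩
  · rw [hsupp]
    exact h₀.nonempty.inl
  have hle : C₀ \ N₀ ≤ F := le_sup_left.trans le_sup_left
  have hBF : B ≤ F := le_sup_right
  -- a walk along the second cycle is simulated by replacing its edges in `N₁`
  have hC₁ : ∀ {x y}, C₁.Reachable x y → F.Reachable x y := by
    rintro x y ⟨p⟩
    induction p with
    | nil => exact .refl _
    | @cons x y z hxy p ih =>
      refine .trans ?_ ih
      by_cases h : N₁.Adj x y
      · obtain ⟨u, hu⟩ := hB₁ x h.mem_support_left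
        obtain ⟨u', hu'⟩ := hB₁ y h.mem_support_right
        exact (hBF hu).reachable.trans
          (((hpath _ _ _ _ h hu hu').mono hle).trans (hBF hu').symm.reachable)
      · exact Adj.reachable (.inl (.inr ⟨hxy, h⟩))
  obtain ⟨n, hn⟩ := hne
  have hto : ∀ u ∈ N₀.support, ∃ w ∈ C₁.support, F.Reachable u w := by
    intro u hu
    obtain ⟨w, hw⟩ := hB₀ u hu
    refine ⟨w, ?_, (hBF hw).reachable⟩
    rcases hBN _ _ hw with h | h
    · exact hs₁ h.2
    · exact absurd (hs₁ h.1) (hd (hs₀ hu))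
  have hall : ∀ v ∈ F.support, ∃ w ∈ C₁.support, F.Reachable v w := by
    intro v hv
    rcases hsub v hv with h | h
    · obtain ⟨u, hu, hr⟩ := h₀.exists_reachable_sdiff hle₀ ⟨n, hn⟩ h
      obtain ⟨w, hw, hr'⟩ := hto u hu
      exact ⟨w, hw, (hr.mono hle).trans hr'⟩
    · exact ⟨v, h, .refl _⟩
  intro u hu v hv
  obtain ⟨w, hw, hr⟩ := hall u hu
  obtain ⟨w', hw', hr'⟩ := hall v hv
  exact hr.trans ((hC₁ (h₁.reachable w hw w' hw')).trans hr'.symm)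

end Splicing

/-! ### Gluing cycles along a doubling of a graph -/

section Doubling
variable {V V' : Type*} {G M N₀ : SimpleGraph V} {G' : SimpleGraph V'} {f : Bool → V ↪ V'}

theorem IsCycleGraph.map {C : SimpleGraph V} (hC : IsCycleGraph C) (g : V ↪ V') :
    IsCycleGraph (C.map g) := by
  have hs := support_map g C
  refine ⟨?_, ?_, ?_⟩
  · rw [hs]
    exact hC.nonempty.image g
  · rw [hs]
    rintro _ ⟨v, hv, rfl⟩
    obtain ⟨a, b, hab, hx⟩ := hC.two_nbrs v hv
    refine ⟨g a, g b, g.injective.ne hab, fun x => ?_⟩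
    rw [map_adj]
    constructor
    · rintro ⟨v', x', h, hv', rfl⟩
      rw [g.injective hv'] at h
      simpa using (hx x').1 h
    · rintro (rfl | rfl)
      · exact ⟨v, a, (hx a).2 (.inl rfl), rfl, rfl⟩
      · exact ⟨v, b, (hx b).2 (.inr rfl), rfl, rfl⟩
  · rw [hs]
    rintro _ ⟨u, hu, rfl⟩ _ ⟨v, hv, rfl⟩
    exact (hC.reachable u hu v hv).map (Embedding.map g C).toHom

theorem IsMatchingGraph.map {M : SimpleGraph V} (hM : IsMatchingGraph M) (g : V ↪ V') :
    IsMatchingGraph (M.map g) := by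
  intro x y z hy hz
  rw [map_adj] at hy hz
  obtain ⟨a, b, hab, rfl, rfl⟩ := hy
  obtain ⟨a', c, hac, ha, rfl⟩ := hz
  rw [g.injective ha] at hac
  rw [hM hab hac]

theorem IsMatchingGraph.comap {M : SimpleGraph V'} (hM : IsMatchingGraph M) (g : V ↪ V') :
    IsMatchingGraph (M.comap g) :=
  fun _ _ _ hb hc => g.injective (hM hb hc)

/-- The embeddings `f false` and `f true` present `G'` as two disjoint copies of `G` together with
the edges between corresponding vertices (and possibly further edges). -/
structure IsDoubling (G : SimpleGraph V) (G' : SimpleGraph V') (f : Bool → V ↪ V') : Prop where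
  cover : ∀ b x, (∃ a, f b a = x) ∨ ∃ a, f (!b) a = x
  ne : ∀ b a a', f b a ≠ f (!b) a'
  adj : ∀ b a a', G.Adj a a' → G'.Adj (f b a) (f b a')
  adj_cross : ∀ b a, G'.Adj (f b a) (f (!b) a)

theorem IsDoubling.ncard_add [Finite V] (h : IsDoubling G G' f) (b : Bool) (T : Set V') :
    (f b ⁻¹' T).ncard + (f (!b) ⁻¹' T).ncard = T.ncard := by
  rw [← Set.ncard_image_of_injective _ (f b).injective,
    ← Set.ncard_image_of_injective _ (f (!b)).injective, ← Set.ncard_union_eq]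
  · congr 1
    ext x
    simp only [Set.mem_union, Set.mem_image, Set.mem_preimage]
    constructor
    · rintro (⟨a, ha, rfl⟩ | ⟨a, ha, rfl⟩) <;> exact ha
    · intro hx
      rcases h.cover b x with ⟨a, rfl⟩ | ⟨a, rfl⟩
      · exact .inl ⟨a, hx, rfl⟩
      · exact .inr ⟨a, hx, rfl⟩
  · rw [Set.disjoint_left]
    rintro _ ⟨a, -, rfl⟩ ⟨a', -, h'⟩
    exact h.ne b a a' h'.symm

theorem IsDoubling.card_eq [Finite V] (h : IsDoubling G G' f) : Nat.card V' = 2 * Nat.card V := by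
  have := h.ncard_add false Set.univ
  simp only [Set.preimage_univ, Set.ncard_univ] at this
  lia

/-- Gluing along a doubling. The relation `X` says which crossing edges the cycle is to use: all
those of `M`, and possibly some of `G'`. On one side their ends are paired by some `N₀`, and the
result extends to a long cycle `C₀` there; the paths of `C₀ \ N₀` then prescribe how to pair
the ends of the crossing edges on the other side. -/
theorem IsDoubling.extends_of_pairing [Finite V] (h : IsDoubling G G' f) {M : SimpleGraph V'}
    (hM : IsMatchingGraph M) (b : Bool) {X : V → V → Prop} (hc : ∃ a a', X a a')
    (hfst : ∀ {u u' w}, X u w → X u' w → u = u') (hsnd : ∀ {u w w'}, X u w → X u w' → w = w')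
    (hMX : ∀ {u w}, M.Adj (f b u) (f (!b) w) → X u w)
    (hXM : ∀ {u w}, X u w → (M ⊔ G').Adj (f b u) (f (!b) w))
    (hN₀ : IsMatchingGraph N₀) (hmem : ∀ {a}, a ∈ N₀.support ↔ ∃ a', X a a')
    (hdisj₀ : ∀ {a a'}, M.Adj (f b a) (f b a') → ¬ N₀.Adj a a')
    (hdisj₁ : ∀ {u w}, X u w → w ∉ (M.comap (f (!b))).support)
    (he : ExtendsToLongCycle G (M.comap (f b) ⊔ N₀))
    (ht : IsExtendableSet G ((M.comap (f (!b))).support ∪ {w | ∃ u, X u w})) :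
    ExtendsToLongCycle G' M := by
  obtain ⟨C₀, hC₀, hle₀, hle₀', hcard₀⟩ := he
  have hNC₀ : N₀ ≤ C₀ := le_sup_right.trans hle₀
  let N₁ : SimpleGraph V :=
    { Adj := fun w w' => w ≠ w' ∧ ∃ u u', X u w ∧ X u' w' ∧ (C₀ \ N₀).Reachable u u'
      symm := ⟨fun w w' ⟨hne, u, u', h1, h2, h3⟩ => ⟨hne.symm, u', u, h2, h1, h3.symm⟩⟩
      loopless := ⟨fun w hw => hw.1 rfl⟩ }
  have hN₁ : IsMatchingGraph N₁ := by
    rintro w w' w'' ⟨hne, u, u', h1, h2, h3⟩ ⟨hne', v, u'', h4, h5, h6⟩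
    obtain rfl := hfst h1 h4
    have hu' : u' ≠ u := by
      rintro rfl
      exact hne (hsnd h1 h2)
    have hu'' : u'' ≠ u := by
      rintro rfl
      exact hne' (hsnd h1 h5)
    have := (hC₀.existsUnique_reachable_sdiff hN₀ hNC₀ (hmem.2 ⟨_, h1⟩)).unique
      ⟨hu', hmem.2 ⟨_, h2⟩, h3⟩ ⟨hu'', hmem.2 ⟨_, h5⟩, h6⟩
    subst this
    exact hsnd h2 h5
  have hs₁ : ∀ {w}, w ∈ N₁.support ↔ ∃ u, X u w := by
    intro w
    constructor
    · rintro ⟨w', -, u, u', h1, -⟩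
      exact ⟨u, h1⟩
    · rintro ⟨u, hu⟩
      obtain ⟨u', ⟨hne, hu', hr⟩, -⟩ :=
        hC₀.existsUnique_reachable_sdiff hN₀ hNC₀ (hmem.2 ⟨_, hu⟩)
      obtain ⟨w', hw'⟩ := hmem.1 hu'
      refine ⟨w', ?_, u, u', hu, hw', hr⟩
      rintro rfl
      exact hne (hfst hw' hu)
  obtain ⟨C₁, hC₁, hle₁, hle₁', hcard₁⟩ := ht (M.comap (f (!b)) ⊔ N₁)
    ((hM.comap _).sup hN₁ (Set.disjoint_left.2 fun w hw hw' =>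
      (hs₁.1 hw').elim fun _ hu => hdisj₁ hu hw)) (by
      ext w
      rw [support_sup, Set.mem_union, hs₁, Set.mem_union]
      rfl)
  have hNC₁ : N₁ ≤ C₁ := le_sup_right.trans hle₁
  let B : SimpleGraph V' :=
    { Adj := fun x y => (∃ a a', X a a' ∧ f b a = x ∧ f (!b) a' = y) ∨
        ∃ a a', X a a' ∧ f (!b) a' = x ∧ f b a = y
      symm := ⟨fun x y hh => hh.symm.imp
        (fun ⟨a, a', h0, h1, h2⟩ => ⟨a, a', h0, h2, h1⟩)
        (fun ⟨a, a', h0, h1, h2⟩ => ⟨a, a', h0, h2, h1⟩)⟩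
      loopless := ⟨by
        rintro x (⟨a, a', -, h1, h2⟩ | ⟨a, a', -, h1, h2⟩)
        · exact h.ne b a a' (h1.trans h2.symm)
        · exact h.ne b a a' (h2.trans h1.symm)⟩ }
  have hB : ∀ {a x}, B.Adj (f b a) x ↔ ∃ a', X a a' ∧ f (!b) a' = x := by
    intro a x
    constructor
    · rintro (⟨c, a', h0, h1, h2⟩ | ⟨c, a', h0, h1, h2⟩)
      · exact ⟨a', (f b).injective h1 ▸ h0, h2⟩
      · exact absurd h1.symm (h.ne b _ _)
    · rintro ⟨a', h0, h1⟩
      exact .inl ⟨a, a', h0, rfl, h1⟩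
  have hB' : ∀ {a' x}, B.Adj (f (!b) a') x ↔ ∃ a, X a a' ∧ f b a = x := by
    intro a' x
    constructor
    · rintro (⟨a, c, h0, h1, h2⟩ | ⟨a, c, h0, h1, h2⟩)
      · exact absurd h1 (h.ne b _ _)
      · exact ⟨a, (f (!b)).injective h1 ▸ h0, h2⟩
    · rintro ⟨a, h0, h1⟩
      exact .inr ⟨a, a', h0, rfl, h1⟩
  have hBm : IsMatchingGraph B := by
    intro x y z hy hz
    rcases h.cover b x with ⟨a, rfl⟩ | ⟨a, rfl⟩
    · obtain ⟨c, h1, rfl⟩ := hB.1 hy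
      obtain ⟨c', h2, rfl⟩ := hB.1 hz
      rw [hsnd h1 h2]
    · obtain ⟨c, h1, rfl⟩ := hB'.1 hy
      obtain ⟨c', h2, rfl⟩ := hB'.1 hz
      rw [hfst h1 h2]
  have hsC₀ := support_map (f b) C₀
  have hsC₁ := support_map (f (!b)) C₁
  have hsN₀ := support_map (f b) N₀
  have hsN₁ := support_map (f (!b)) N₁
  have hd : Disjoint (C₀.map (f b)).support (C₁.map (f (!b))).support := by
    rw [hsC₀, hsC₁, Set.disjoint_left]
    rintro _ ⟨a, -, rfl⟩ ⟨a', -, h'⟩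
    exact h.ne b a a' h'.symm
  obtain ⟨hF, hFs⟩ := (hC₀.map (f b)).splice (hC₁.map (f (!b))) hd (hN₀.map (f b))
    (SimpleGraph.map_monotone _ hNC₀) (hN₁.map (f (!b))) (SimpleGraph.map_monotone _ hNC₁)
    hBm
    (by
      rw [hsN₀, hsN₁]
      rintro _ _ (⟨a, a', h0, rfl, rfl⟩ | ⟨a, a', h0, rfl, rfl⟩)
      · exact .inl ⟨⟨a, hmem.2 ⟨_, h0⟩, rfl⟩, ⟨a', hs₁.2 ⟨_, h0⟩, rfl⟩⟩
      · exact .inr ⟨⟨a', hs₁.2 ⟨_, h0⟩, rfl⟩, ⟨a, hmem.2 ⟨_, h0⟩, rfl⟩⟩)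
    (by
      rw [hsN₀]
      rintro _ ⟨a, ha, rfl⟩
      obtain ⟨a', ha'⟩ := hmem.1 ha
      exact ⟨_, hB.2 ⟨_, ha', rfl⟩⟩)
    (by
      rw [hsN₁]
      rintro _ ⟨a, ha, rfl⟩
      obtain ⟨a', ha'⟩ := hs₁.1 ha
      exact ⟨_, hB'.2 ⟨_, ha', rfl⟩⟩)
    (by
      obtain ⟨a, a', ha⟩ := hc
      rw [hsN₀]
      exact ⟨_, a, hmem.2 ⟨_, ha⟩, rfl⟩)
    (by
      intro w w' u u' hw hu hu'
      rw [map_adj] at hw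
      obtain ⟨x, x', ⟨hne, y, y', h1, h2, h3⟩, rfl, rfl⟩ := hw
      obtain ⟨v, hv, rfl⟩ := hB'.1 hu
      obtain ⟨v', hv', rfl⟩ := hB'.1 hu'
      rw [hfst hv h1, hfst hv' h2]
      refine (h3.map (Embedding.map (f b) _).toHom).mono ?_
      intro p q hpq
      rw [map_adj] at hpq
      obtain ⟨p', q', hpq, rfl, rfl⟩ := hpq
      simpa using hpq)
  refine ⟨_, hF, ?_, ?_, ?_⟩
  · intro x y hxy
    rcases h.cover b x with ⟨a, rfl⟩ | ⟨a, rfl⟩ <;> rcases h.cover b y with ⟨a', rfl⟩ | ⟨a', rfl⟩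
    · have ha : (M.comap (f b)).Adj a a' := hxy
      refine .inl (.inl ?_)
      simp only [sdiff_adj, map_adj_apply]
      exact ⟨hle₀ (.inl ha), hdisj₀ ha⟩
    · exact .inr (hB.2 ⟨_, hMX hxy, rfl⟩)
    · exact .inr (hB'.2 ⟨_, hMX hxy.symm, rfl⟩)
    · have ha : (M.comap (f (!b))).Adj a a' := hxy
      refine .inl (.inr ?_)
      simp only [sdiff_adj, map_adj_apply]
      exact ⟨hle₁ (.inl ha), fun hn => (hs₁.1 hn.mem_support_left).elim fun _ hu =>
        hdisj₁ hu ha.mem_support_left⟩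
  · rintro x y ((hxy | hxy) | hxy)
    · obtain ⟨h1, h2⟩ := hxy
      rw [map_adj] at h1
      obtain ⟨a, a', ha, rfl, rfl⟩ := h1
      rw [map_adj_apply] at h2
      rcases hle₀' ha with (h' | h') | h'
      · exact .inl h'
      · exact absurd h' h2
      · exact .inr (h.adj _ _ _ h')
    · obtain ⟨h1, h2⟩ := hxy
      rw [map_adj] at h1
      obtain ⟨a, a', ha, rfl, rfl⟩ := h1
      rw [map_adj_apply] at h2
      rcases hle₁' ha with (h' | h') | h'
      · exact .inl h'
      · exact absurd h' h2
      · exact .inr (h.adj _ _ _ h')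
    · rcases hxy with ⟨a, a', h0, rfl, rfl⟩ | ⟨a, a', h0, rfl, rfl⟩
      · exact hXM h0
      · exact (hXM h0).symm
  · rw [hFs, Set.ncard_union_eq hd (hsC₀ ▸ Set.toFinite _) (hsC₁ ▸ Set.toFinite _), hsC₀, hsC₁,
      Set.ncard_image_of_injective _ (f b).injective,
      Set.ncard_image_of_injective _ (f (!b)).injective, h.card_eq]
    lia

end Doubling

/-! ### Edges of a cycle avoiding a small set -/

section Counting
variable {V : Type*} {C M : SimpleGraph V}

/-- A long enough cycle has an edge outside a given matching that avoids a given small set `F`: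
count the pairs of adjacent vertices. -/
theorem IsCycleGraph.exists_adj_avoiding [Finite V] (hC : IsCycleGraph C)
    (hM : IsMatchingGraph M) (F : Set V)
    (hcount : M.support.ncard + 4 * F.ncard < 2 * C.support.ncard) :
    ∃ p q, C.Adj p q ∧ ¬ M.Adj p q ∧ p ∉ F ∧ q ∉ F := by
  classical
  have := Fintype.ofFinite V
  by_contra! hcon
  have hdegC : ∀ v, C.degree v = if v ∈ C.support then 2 else 0 := by
    intro v
    split_ifs with hv
    · obtain ⟨a, b, hab, hx⟩ := hC.two_nbrs v hv
      rw [← card_neighborFinset_eq_degree, ← Finset.card_pair hab]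
      congr 1
      ext x
      simp [hx]
    · exact (C.degree_eq_zero_iff_notMem_support v).2 hv
  have hdegM : ∀ v, M.degree v ≤ if v ∈ M.support then 1 else 0 := by
    intro v
    split_ifs with hv
    · rw [← card_neighborFinset_eq_degree, Finset.card_le_one]
      intro a ha b hb
      exact hM (by simpa using ha) (by simpa using hb)
    · exact ((M.degree_eq_zero_iff_notMem_support v).2 hv).le
  have hpt : ∀ v, C.degree v ≤ (if v ∈ M.support then 1 else 0) + (if v ∈ F then 2 else 0) +
      ∑ w, if C.Adj v w ∧ w ∈ F then 1 else 0 := by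
    intro v
    by_cases hv : v ∈ F
    · have := hdegC v
      split_ifs at * <;> lia
    · have hsub : C.neighborFinset v ⊆
          M.neighborFinset v ∪ Finset.univ.filter fun w => C.Adj v w ∧ w ∈ F := by
        intro w hw
        simp only [mem_neighborFinset, Finset.mem_union, Finset.mem_filter, Finset.mem_univ,
          true_and] at hw ⊢
        by_contra! h
        exact h.2 hw (hcon v w hw h.1 hv)
      have h1 := (Finset.card_le_card hsub).trans (Finset.card_union_le _ _)
      rw [card_neighborFinset_eq_degree, card_neighborFinset_eq_degree, Finset.card_filter] at h1
      exact h1.trans (by have := hdegM v; lia)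
  have hcol : ∑ v, ∑ w, (if C.Adj v w ∧ w ∈ F then 1 else 0) ≤ ∑ w, if w ∈ F then 2 else 0 := by
    rw [Finset.sum_comm]
    refine Finset.sum_le_sum fun w _ => ?_
    split_ifs with hw
    · have : ∑ v, (if C.Adj v w ∧ w ∈ F then 1 else 0) = C.degree w := by
        rw [← card_neighborFinset_eq_degree, ← Finset.card_filter]
        congr 1
        ext v
        simp [hw, C.adj_comm]
      rw [this, hdegC w]
      split_ifs <;> lia
    · simp [hw]
  have hcard : ∀ (S : Set V) (k : ℕ) [DecidablePred (· ∈ S)],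
      (∑ v, if v ∈ S then k else 0) = k * S.ncard := by
    intro S k _
    rw [← Finset.sum_filter, Finset.sum_const, smul_eq_mul, mul_comm, Set.ncard_eq_toFinset_card',
      Set.toFinset]
    congr 2
    ext; simp
  have hsum := Finset.sum_le_sum fun v (_ : v ∈ Finset.univ) => hpt v
  rw [Finset.sum_add_distrib, Finset.sum_add_distrib, Finset.sum_congr rfl fun v _ => hdegC v,
    hcard, hcard, hcard] at hsum
  rw [hcard] at hcol
  lia

end Counting

/-! ### Splitting a matching along a doubling -/

section Splitting
variable {V V' : Type*} {G : SimpleGraph V} {G' : SimpleGraph V'} {f : Bool → V ↪ V'}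

theorem ExtendsToLongCycle.of_sup_edge {M : SimpleGraph V} {x y : V} (hG : G.Adj x y)
    (he : ExtendsToLongCycle G (M ⊔ edge x y)) : ExtendsToLongCycle G M := by
  obtain ⟨C, hC, h1, h2, h3⟩ := he
  refine ⟨C, hC, le_sup_left.trans h1, h2.trans ?_, h3⟩
  exact sup_le (sup_le le_sup_left (((edge_le_iff _).2 (.inr hG)).trans le_sup_right)) le_sup_right

theorem IsDoubling.preimage_support (h : IsDoubling G G' f) (M : SimpleGraph V') (b : Bool) :
    f b ⁻¹' M.support = (M.comap (f b)).support ∪ {a | ∃ a', M.Adj (f b a) (f (!b) a')} := by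
  ext a
  constructor
  · rintro ⟨x, hx⟩
    rcases h.cover b x with ⟨a', rfl⟩ | ⟨a', rfl⟩
    · exact .inl ⟨a', hx⟩
    · exact .inr ⟨a', hx⟩
  · rintro (⟨a', ha'⟩ | ⟨a', ha'⟩) <;> exact ⟨_, ha'⟩

/-- Both sides contain an even number of matched vertices, and some edge of `M` crosses. -/
theorem IsDoubling.extends_of_even [Finite V] (h : IsDoubling G G' f) {M : SimpleGraph V'}
    (hM : IsMatchingGraph M) (b : Bool) (hc : ∃ a a', M.Adj (f b a) (f (!b) a'))
    (heven : Even (f b ⁻¹' M.support).ncard) (h₀ : IsExtendableSet G (f b ⁻¹' M.support))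
    (h₁ : IsExtendableSet G (f (!b) ⁻¹' M.support)) : ExtendsToLongCycle G' M := by
  set U : Set V := {a | ∃ a', M.Adj (f b a) (f (!b) a')} with hU
  have hd : Disjoint (M.comap (f b)).support U := by
    rw [Set.disjoint_left]
    rintro a ⟨a', ha'⟩ ⟨w, hw⟩
    exact h.ne b _ _ (hM ha' hw)
  have hT := h.preimage_support M b
  have hUe : Even U.ncard := by
    rw [hT, Set.ncard_union_eq hd] at heven
    exact (Nat.even_add.1 heven).1 (hM.comap (f b)).even_ncard_support
  obtain ⟨N₀, hN₀, hs⟩ := exists_isMatchingGraph_support_eq U hUe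
  have hmem : ∀ {a}, a ∈ N₀.support ↔ ∃ a', M.Adj (f b a) (f (!b) a') := fun {a} => by
    rw [hs]; rfl
  refine h.extends_of_pairing hM b (X := fun a a' => M.Adj (f b a) (f (!b) a')) hc
    (fun h1 h2 => (f b).injective (hM h1.symm h2.symm))
    (fun h1 h2 => (f (!b)).injective (hM h1 h2)) id .inl hN₀ hmem ?_ ?_ ?_ ?_
  · intro a a' ha hn
    rw [← hs, Set.disjoint_left] at hd
    exact hd (a := a) ⟨a', ha⟩ hn.mem_support_left
  · rintro u w hu ⟨w', hw'⟩
    exact h.ne b _ _ (hM hu.symm hw')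
  · refine h₀ _ ((hM.comap _).sup hN₀ (hs ▸ hd)) ?_
    rw [support_sup, hs, hT]
  · convert h₁ using 1
    rw [h.preimage_support]
    simp only [Bool.not_not, adj_comm]

/-- Both sides contain an odd number of matched vertices: an edge of `G'` joining two unmatched
vertices is added to `M`. -/
theorem IsDoubling.extends_of_odd [Finite V] (h : IsDoubling G G' f) {M : SimpleGraph V'}
    (hM : IsMatchingGraph M) (b : Bool) (hodd : Odd (f b ⁻¹' M.support).ncard) {x : V}
    (hx : x ∉ f b ⁻¹' M.support) (hx' : x ∉ f (!b) ⁻¹' M.support)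
    (h₀ : IsExtendableSet G (insert x (f b ⁻¹' M.support)))
    (h₁ : IsExtendableSet G (insert x (f (!b) ⁻¹' M.support))) : ExtendsToLongCycle G' M := by
  have hne := h.ne b x x
  have hs : (M ⊔ edge (f b x) (f (!b) x)).support = M.support ∪ {f b x, f (!b) x} := by
    rw [support_sup, support_edge hne]
  have hT : f b ⁻¹' (M ⊔ edge (f b x) (f (!b) x)).support = insert x (f b ⁻¹' M.support) := by
    ext a
    have := h.ne b a x
    simp only [hs, Set.mem_preimage, Set.mem_union, Set.mem_insert_iff, Set.mem_singleton_iff,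
      (f b).injective.eq_iff]
    tauto
  have hT' : f (!b) ⁻¹' (M ⊔ edge (f b x) (f (!b) x)).support =
      insert x (f (!b) ⁻¹' M.support) := by
    ext a
    have := (h.ne b x a).symm
    simp only [hs, Set.mem_preimage, Set.mem_union, Set.mem_insert_iff, Set.mem_singleton_iff,
      (f (!b)).injective.eq_iff]
    tauto
  refine .of_sup_edge (h.adj_cross b x) (h.extends_of_even (hM.sup (isMatchingGraph_edge _ _) ?_)
    b ⟨x, x, .inr ?_⟩ ?_ (hT ▸ h₀) (hT' ▸ h₁))
  · rw [support_edge hne, Set.disjoint_left]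
    rintro _ hm (rfl | rfl)
    · exact hx hm
    · exact hx' hm
  · exact (edge_adj ..).2 ⟨.inl ⟨rfl, rfl⟩, hne⟩
  · rw [hT, Set.ncard_insert_of_notMem hx]
    exact hodd.add_one

/-- No edge of `M` crosses: an edge `pq` of the long cycle `C₀` on one side is replaced by a
detour through the other side, where a cycle through the additional matching edge `pq` is
taken. -/
theorem IsDoubling.extends_of_not_crossing [Finite V] (h : IsDoubling G G' f)
    {M : SimpleGraph V'} (hM : IsMatchingGraph M) (b : Bool)
    (hc : ∀ a a', ¬ M.Adj (f b a) (f (!b) a')) (h₀ : IsExtendableSet G (f b ⁻¹' M.support))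
    (hcount : 2 * ((f b ⁻¹' M.support).ncard + 4 * (f (!b) ⁻¹' M.support).ncard) <
      3 * Nat.card V)
    (h₁ : ∀ p q, p ≠ q → p ∉ f (!b) ⁻¹' M.support → q ∉ f (!b) ⁻¹' M.support →
      IsExtendableSet G (f (!b) ⁻¹' M.support ∪ {p, q})) : ExtendsToLongCycle G' M := by
  have hT : f b ⁻¹' M.support = (M.comap (f b)).support := by
    rw [h.preimage_support]
    simp [hc]
  have hT' : f (!b) ⁻¹' M.support = (M.comap (f (!b))).support := by
    rw [h.preimage_support]
    simp [adj_comm, hc]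
  rw [hT] at h₀ hcount
  obtain ⟨C₀, hC₀, hle, hle', hcard⟩ := h₀ _ (hM.comap _) rfl
  obtain ⟨p, q, hpq, hpqM, hp, hq⟩ := hC₀.exists_adj_avoiding (hM.comap (f b))
    (f (!b) ⁻¹' M.support) (by lia)
  have hne := hpq.ne
  have hs := support_edge hne
  refine h.extends_of_pairing hM b (N₀ := edge p q) (X := fun a a' => a = a' ∧ (a = p ∨ a = q))
    ⟨p, p, rfl, .inl rfl⟩ (fun h1 h2 => h1.1.trans h2.1.symm) (fun h1 h2 => h1.1.symm.trans h2.1)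
    (fun h1 => absurd h1 (hc _ _)) ?_ (isMatchingGraph_edge p q) ?_ ?_ ?_ ?_ ?_
  · rintro u _ ⟨rfl, -⟩
    exact .inr (h.adj_cross b u)
  · intro a
    rw [hs]
    simp
  · intro a a' ha hn
    rw [edge_adj] at hn
    rcases hn.1 with ⟨rfl, rfl⟩ | ⟨rfl, rfl⟩
    · exact hpqM ha
    · exact hpqM ha.symm
  · rintro u _ ⟨rfl, rfl | rfl⟩
    · rwa [← hT']
    · rwa [← hT']
  · refine ⟨C₀, hC₀, sup_le hle ((edge_le_iff _).2 (.inr hpq)), hle'.trans ?_, hcard⟩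
    exact sup_le_sup_right le_sup_left _
  · rw [← hT']
    convert h₁ p q hne hp hq using 2
    ext w
    simp

end Splitting

/-! ### Facets of the hypercube -/

section Hypercube
variable {n : ℕ}

/-- The facet of `Q_{n+1}` in which coordinate `d` equals `b`, as a copy of `Q_n`. -/
def facet (d : Fin (n + 1)) (b : Bool) : (Fin n → Bool) ↪ (Fin (n + 1) → Bool) :=
  ⟨fun v => Fin.insertNth (α := fun _ => Bool) d b v,
    Fin.insertNth_right_injective (α := fun _ => Bool) b⟩

theorem facet_apply_same (d : Fin (n + 1)) (b : Bool) (v : Fin n → Bool) : facet d b v d = b :=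
  Fin.insertNth_apply_same (α := fun _ => Bool) d b v

theorem exists_facet_eq {d : Fin (n + 1)} {b : Bool} {x : Fin (n + 1) → Bool} (h : x d = b) :
    ∃ v, facet d b v = x :=
  ⟨Fin.removeNth d x, by subst h; exact Fin.insertNth_self_removeNth d x⟩

theorem hammingDist_facet (d : Fin (n + 1)) (b b' : Bool) (u v : Fin n → Bool) :
    hammingDist (facet d b u) (facet d b' v) = (if b ≠ b' then 1 else 0) + hammingDist u v := by
  simp only [hammingDist, Finset.card_filter]
  rw [Fin.sum_univ_succAbove _ d]
  simp [facet]

theorem isDoubling_facet (d : Fin (n + 1)) :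
    IsDoubling (hypercube n) (hypercube (n + 1)) (facet d) where
  cover b x := by
    by_cases h : x d = b
    · exact .inl (exists_facet_eq h)
    · exact .inr (exists_facet_eq (by cases b <;> simpa using h))
  ne b a a' h := by
    have := congrFun h d
    rw [facet_apply_same, facet_apply_same] at this
    simp at this
  adj b a a' h := by
    change hammingDist _ _ = 1
    rw [hammingDist_facet]
    simp only [ne_eq, not_true_eq_false, if_false, zero_add]
    exact h
  adj_cross b a := by
    change hammingDist _ _ = 1
    rw [hammingDist_facet]
    simp

theorem exists_crossing_facet {M : SimpleGraph (Fin (n + 1) → Bool)}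
    {u v : Fin (n + 1) → Bool} (h : M.Adj u v) {d : Fin (n + 1)} (hd : u d ≠ v d) (b : Bool) :
    ∃ a a', M.Adj (facet d b a) (facet d (!b) a') := by
  by_cases hu : u d = b
  · obtain ⟨a, rfl⟩ := exists_facet_eq hu
    obtain ⟨a', rfl⟩ := exists_facet_eq (d := d) (b := !b) (x := v)
      (by rw [hu] at hd; revert hd; cases v d <;> cases b <;> simp)
    exact ⟨a, a', h⟩
  · obtain ⟨a, rfl⟩ := exists_facet_eq (d := d) (b := !b) (x := u)
      (by revert hu; cases u d <;> cases b <;> simp)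
    obtain ⟨a', rfl⟩ := exists_facet_eq (d := d) (b := b) (x := v)
      (by rw [facet_apply_same] at hd; revert hd; cases v d <;> cases b <;> simp)
    exact ⟨a', a, h.symm⟩

/-- The number of elements of `T` in a facet. -/
noncomputable def facetCount (T : Set (Fin (n + 1) → Bool)) (d : Fin (n + 1)) (b : Bool) : ℕ :=
  (facet d b ⁻¹' T).ncard

theorem facetCount_add (T : Set (Fin (n + 1) → Bool)) (d : Fin (n + 1)) (b : Bool) :
    facetCount T d b + facetCount T d (!b) = T.ncard :=
  (isDoubling_facet d).ncard_add b T

theorem facetCount_eq (T : Set (Fin (n + 1) → Bool)) (d : Fin (n + 1)) (b : Bool) :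
    facetCount T d b = {x ∈ T | x d = b}.ncard := by
  rw [facetCount, ← Set.ncard_image_of_injective _ (facet d b).injective]
  congr 1
  ext x
  constructor
  · rintro ⟨v, hv, rfl⟩
    exact ⟨hv, facet_apply_same d b v⟩
  · rintro ⟨hx, h⟩
    obtain ⟨v, rfl⟩ := exists_facet_eq h
    exact ⟨v, hx, rfl⟩

theorem card_hammingDist_eq_one_le (w : Fin n → Bool) :
    (Finset.univ.filter fun v => hammingDist v w = 1).card ≤ n := by
  have hsub : (Finset.univ.filter fun v => hammingDist v w = 1) ⊆
      Finset.univ.image fun d => Function.update w d (!w d) := by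
    intro v hv
    simp only [Finset.mem_filter, Finset.mem_univ, true_and, hammingDist] at hv
    obtain ⟨d, hd⟩ := Finset.card_eq_one.1 hv
    simp only [Finset.mem_image, Finset.mem_univ, true_and]
    refine ⟨d, ?_⟩
    have hd' : ∀ i, v i ≠ w i ↔ i = d := fun i => by
      simpa using Finset.ext_iff.1 hd i
    ext i
    by_cases h : i = d
    · subst h
      have := (hd' i).2 rfl
      simp only [Function.update_self]
      cases hv : v i <;> cases hw : w i <;> simp_all
    · rw [Function.update_of_ne h]
      by_contra h'
      exact h ((hd' i).1 (Ne.symm (by simpa using h')))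
  refine (Finset.card_le_card hsub).trans (Finset.card_image_le.trans ?_)
  simp

/-- In each direction let `w` pick the facet with more elements of `T`. The minority counts add up
to the sum of the distances from `w` to the elements of `T`; at most one of these is `0` and at most
`n + 1` of them are `1`. -/
theorem exists_majority (T : Set (Fin (n + 1) → Bool)) :
    ∃ w : Fin (n + 1) → Bool, (∀ d, facetCount T d (!w d) ≤ facetCount T d (w d)) ∧
      2 * T.ncard ≤ ∑ d, facetCount T d (!w d) + (n + 3) := by
  classical
  have hmaj : ∀ d, ∃ b, facetCount T d (!b) ≤ facetCount T d b := by
    intro d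
    rcases le_total (facetCount T d true) (facetCount T d false) with h | h
    · exact ⟨false, h⟩
    · exact ⟨true, h⟩
  choose w hw using hmaj
  refine ⟨w, hw, ?_⟩
  let S := T.toFinset
  have hcount : ∀ d, facetCount T d (!w d) = ∑ v ∈ S, if v d ≠ w d then 1 else 0 := by
    intro d
    rw [facetCount_eq, ← Finset.card_filter, ← Set.ncard_coe_finset]
    congr 1
    ext v
    have : v d = (!w d) ↔ v d ≠ w d := by cases v d <;> cases w d <;> simp
    simp [S, this]
  have hsum : ∑ d, facetCount T d (!w d) = ∑ v ∈ S, hammingDist v w := by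
    rw [Finset.sum_congr rfl fun d _ => hcount d, Finset.sum_comm]
    refine Finset.sum_congr rfl fun v _ => ?_
    rw [hammingDist, Finset.card_filter]
  have hpt : ∀ v ∈ S, 2 ≤ hammingDist v w + ((if v = w then 2 else 0) +
      if hammingDist v w = 1 then 1 else 0) := by
    intro v _
    split_ifs with h1 h2 h2
    · lia
    · lia
    · lia
    · have := hammingDist_ne_zero.2 h1
      lia
  have hle := Finset.sum_le_sum hpt
  rw [Finset.sum_const, Finset.sum_add_distrib, Finset.sum_add_distrib, ← hsum] at hle
  have h2 : ∑ v ∈ S, (if v = w then 2 else 0) ≤ 2 := by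
    rw [Finset.sum_ite_eq']
    split_ifs <;> simp
  have h1 : ∑ v ∈ S, (if hammingDist v w = 1 then 1 else 0) ≤ n + 1 := by
    rw [← Finset.card_filter]
    exact (Finset.card_le_card (Finset.filter_subset_filter _ (Finset.subset_univ S))).trans
      (card_hammingDist_eq_one_le w)
  have hS : S.card = T.ncard := (Set.ncard_eq_toFinset_card' T).symm
  rw [hS, smul_eq_mul] at hle
  lia

/-- Every matching of at most `c` vertices of `Q_n` extends to a long cycle. -/
def ExtendsUpTo (n c : ℕ) : Prop :=
  ∀ M : SimpleGraph (Fin n → Bool), IsMatchingGraph M → M.support.ncard ≤ c →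
    ExtendsToLongCycle (hypercube n) M

theorem ExtendsUpTo.isExtendableSet {c : ℕ} (h : ExtendsUpTo n c) {T : Set (Fin n → Bool)}
    (hT : T.ncard ≤ c) : IsExtendableSet (hypercube n) T :=
  fun M hM hs => h M hM (hs ▸ hT)

theorem ExtendsUpTo.mono {c c' : ℕ} (h : ExtendsUpTo n c) (hc : c' ≤ c) : ExtendsUpTo n c' :=
  fun M hM hs => h M hM (hs.trans hc)

theorem exists_notMem_preimage_facet {T : Set (Fin (n + 1) → Bool)} (hT : T.ncard < 2 ^ n)
    (d : Fin (n + 1)) (b : Bool) : ∃ x, x ∉ facet d b ⁻¹' T ∧ x ∉ facet d (!b) ⁻¹' T := by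
  by_contra! hall
  have h1 := Set.ncard_union_le (facet d b ⁻¹' T) (facet d (!b) ⁻¹' T)
  have h2 : facet d b ⁻¹' T ∪ facet d (!b) ⁻¹' T = Set.univ :=
    Set.eq_univ_of_forall fun x => by
      by_cases h : x ∈ facet d b ⁻¹' T
      · exact .inl h
      · exact .inr (hall x h)
  have h3 : Nat.card (Fin n → Bool) = 2 ^ n := by simp
  rw [h2, Set.ncard_univ, h3, (isDoubling_facet d).ncard_add b T] at h1
  lia

/-- A matching of `Q_{n+1}` extends to a long cycle if the facets in some direction contain few
matched vertices. -/
theorem ExtendsUpTo.extends_of_facetCount {c : ℕ} (h : ExtendsUpTo n c) (hce : Even c)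
    {M : SimpleGraph (Fin (n + 1) → Bool)} (hM : IsMatchingGraph M) (d : Fin (n + 1)) (b : Bool)
    (hb : facetCount M.support d b ≤ c) (hb' : facetCount M.support d (!b) ≤ c)
    (hx : Odd (facetCount M.support d b) →
      ∃ x, x ∉ facet d b ⁻¹' M.support ∧ x ∉ facet d (!b) ⁻¹' M.support)
    (hor : (∃ a a', M.Adj (facet d b a) (facet d (!b) a')) ∨
      facetCount M.support d (!b) + 2 ≤ c ∧
        2 * (facetCount M.support d b + 4 * facetCount M.support d (!b)) < 3 * 2 ^ n) :
    ExtendsToLongCycle (hypercube (n + 1)) M := by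
  have hD := isDoubling_facet d
  have hadd := facetCount_add M.support d b
  have hMe := hM.even_ncard_support
  have hV : Nat.card (Fin n → Bool) = 2 ^ n := by simp
  rcases Nat.even_or_odd (facetCount M.support d b) with he | ho
  · by_cases hc : ∃ a a', M.Adj (facet d b a) (facet d (!b) a')
    · exact hD.extends_of_even hM b hc he (h.isExtendableSet hb) (h.isExtendableSet hb')
    · obtain ⟨h2, hcount⟩ := hor.resolve_left hc
      refine hD.extends_of_not_crossing hM b (by simpa using hc) (h.isExtendableSet hb)
        (by rw [hV]; exact hcount) fun p q hpq hp hq => h.isExtendableSet ?_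
      exact (Set.ncard_union_le _ _).trans (by rw [Set.ncard_pair hpq]; exact h2)
  · have ho' : Odd (facetCount M.support d (!b)) := by grind
    obtain ⟨x, hx⟩ := hx ho
    refine hD.extends_of_odd hM b ho hx.1 hx.2 (h.isExtendableSet ?_) (h.isExtendableSet ?_)
    · rw [Set.ncard_insert_of_notMem hx.1]
      change facetCount M.support d b + 1 ≤ c
      grind
    · rw [Set.ncard_insert_of_notMem hx.2]
      change facetCount M.support d (!b) + 1 ≤ c
      grind

/-- The induction step: if a matching has more than `c` vertices, then `exists_majority` yields a
direction in which both facets contain at most `c` of them; this is what `h1` is for. If no edge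
crosses, `h2` leaves room for an additional edge in the smaller facet, and `h3` makes the cycle in the
larger facet long enough to have an edge that can be replaced by a detour. -/
theorem ExtendsUpTo.step {c t : ℕ} (h : ExtendsUpTo n c) (hce : Even c)
    (h1 : n * t + 2 < 2 * c + t) (h2 : t + 4 ≤ c) (h3 : 5 * (c + t) < 3 * 2 ^ n) :
    ExtendsUpTo (n + 1) (c + t) := by
  intro M hM hm
  obtain ⟨w, hw, hsum⟩ := exists_majority M.support
  obtain ⟨d, hd⟩ : ∃ d, M.support.ncard ≤ facetCount M.support d (!w d) + c := by
    by_contra! hcon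
    have hle : ∑ d, (facetCount M.support d (!w d) + (c + 1)) ≤ ∑ d : Fin (n + 1),
        M.support.ncard := Finset.sum_le_sum fun d _ => hcon d
    simp only [Finset.sum_add_distrib, Finset.sum_const, Finset.card_univ, Fintype.card_fin,
      smul_eq_mul] at hle
    have h0 := hcon 0
    obtain ⟨k, hk⟩ : ∃ k, M.support.ncard = c + 1 + k := Nat.exists_eq_add_of_le (by lia)
    rw [hk] at hle hsum hm
    have hkt : n * (k + 1) ≤ n * t := Nat.mul_le_mul_left n (by lia)
    rcases n.eq_zero_or_pos with rfl | hn
    · lia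
    · obtain ⟨n, rfl⟩ := Nat.exists_eq_succ_of_ne_zero hn.ne'
      nlinarith
  have hadd := facetCount_add M.support d (w d)
  have := hw d
  exact h.extends_of_facetCount hce hM d (w d) (by lia) (by lia)
    (fun _ => exists_notMem_preimage_facet (by lia) d _)
    (.inr ⟨by lia, by lia⟩)

end Hypercube

/-! ### Matchings with at most two edges -/

section SmallMatchings
variable {V : Type*}

/-- A cyclic sequence of `k + 3` distinct vertices spans a cycle. -/
theorem isCycleGraph_cycleGraph (k : ℕ) : IsCycleGraph (cycleGraph (k + 3)) where
  nonempty := ⟨0, 1, cycleGraph_adj.2 (by simp)⟩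
  two_nbrs v _ := by
    refine ⟨v + 1, v - 1, ?_, fun x => ?_⟩
    · intro h
      have h2 : (1 : Fin (k + 3)) + 1 = 0 := by
        rw [sub_eq_add_neg, add_right_inj] at h
        nth_rewrite 1 [h]
        simp
      have h3 := congrArg Fin.val h2
      rw [Fin.val_add, Fin.val_one, Fin.val_zero, Nat.mod_eq_of_lt (by lia)] at h3
      lia
    · rw [cycleGraph_adj, or_comm]
      refine or_congr ⟨fun h => ?_, fun h => ?_⟩ ⟨fun h => ?_, fun h => ?_⟩
      · rw [← h]; simp
      · rw [h]; simp
      · rw [← h]; simp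
      · rw [h]; simp
  reachable u _ v _ := cycleGraph_connected.preconnected u v

theorem extendsToLongCycle_of_cyclic_sequence [Finite V] {G M : SimpleGraph V} {k : ℕ}
    (c : Fin (k + 3) → V) (hc : Function.Injective c)
    (hM : ∀ x y, M.Adj x y → ∃ i, (c i = x ∧ c (i + 1) = y) ∨ (c i = y ∧ c (i + 1) = x))
    (hG : ∀ i, M.Adj (c i) (c (i + 1)) ∨ G.Adj (c i) (c (i + 1)))
    (hcard : 3 * Nat.card V ≤ 4 * (k + 3)) : ExtendsToLongCycle G M := by
  have hadj : ∀ i, (cycleGraph (k + 3)).Adj i (i + 1) := fun i => by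
    rw [cycleGraph_adj]; simp
  have hC := isCycleGraph_cycleGraph k
  have hs := support_map (⟨c, hc⟩ : Fin (k + 3) ↪ V) (cycleGraph (k + 3))
  refine ⟨(cycleGraph (k + 3)).map (⟨c, hc⟩ : Fin (k + 3) ↪ V), hC.map _, ?_, ?_, ?_⟩
  · intro x y hxy
    rw [map_adj]
    obtain ⟨i, ⟨rfl, rfl⟩ | ⟨rfl, rfl⟩⟩ := hM x y hxy
    · exact ⟨i, i + 1, hadj i, rfl, rfl⟩
    · exact ⟨i + 1, i, (hadj i).symm, rfl, rfl⟩
  · intro x y hxy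
    rw [map_adj] at hxy
    obtain ⟨i, j, hij, rfl, rfl⟩ := hxy
    rw [cycleGraph_adj] at hij
    rcases hij with h | h
    · obtain rfl : i = j + 1 := by rw [← h]; simp
      exact (hG j).imp (·.symm) (·.symm)
    · obtain rfl : j = i + 1 := by rw [← h]; simp
      exact hG i
  · have : (cycleGraph (k + 3)).support = Set.univ := by
      ext i
      simpa using ⟨i + 1, hadj i⟩
    rw [hs, Set.ncard_image_of_injective _ (Function.Embedding.injective _), this,
      Set.ncard_univ, Nat.card_fin]
    exact hcard

/-- Matchings with at most two edges. -/
theorem IsMatchingGraph.eq_of_ncard_support_le_four [Finite V] {M : SimpleGraph V}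
    (hM : IsMatchingGraph M) (h : M.support.ncard ≤ 4) :
    M = ⊥ ∨ (∃ a b, a ≠ b ∧ M = edge a b) ∨
      ∃ a b c d, [a, b, c, d].Nodup ∧ M = edge a b ⊔ edge c d := by
  classical
  by_cases hbot : M = ⊥
  · exact .inl hbot
  obtain ⟨a, b, hab⟩ := ne_bot_iff_exists_adj.1 hbot
  by_cases hone : ∀ x y, M.Adj x y → (x = a ∧ y = b) ∨ (x = b ∧ y = a)
  · refine .inr (.inl ⟨a, b, hab.ne, ?_⟩)
    ext x y
    rw [edge_adj]
    exact ⟨fun h => ⟨hone x y h, h.ne⟩,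
      by rintro ⟨⟨rfl, rfl⟩ | ⟨rfl, rfl⟩, -⟩; exacts [hab, hab.symm]⟩
  push Not at hone
  obtain ⟨c, d, hcd, h1, h2⟩ := hone
  have hca : c ≠ a := by rintro rfl; exact h1 rfl (hM hcd hab)
  have hcb : c ≠ b := by rintro rfl; exact h2 rfl (hM hcd hab.symm)
  have hda : d ≠ a := by rintro rfl; exact hcb (hM hcd.symm hab)
  have hdb : d ≠ b := by rintro rfl; exact hca (hM hcd.symm hab.symm)
  have hnd : [a, b, c, d].Nodup := by
    simp [hab.ne, hca.symm, hcb.symm, hda.symm, hdb.symm, hcd.ne]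
  refine .inr (.inr ⟨a, b, c, d, hnd, ?_⟩)
  have hsub : (({a, b, c, d} : Finset V) : Set V) ⊆ M.support := by
    intro x hx
    simp only [Finset.coe_insert, Finset.coe_singleton, Set.mem_insert_iff,
      Set.mem_singleton_iff] at hx
    rcases hx with rfl | rfl | rfl | rfl
    exacts [⟨_, hab⟩, ⟨_, hab.symm⟩, ⟨_, hcd⟩, ⟨_, hcd.symm⟩]
  have hcard : ({a, b, c, d} : Finset V).card = 4 := by
    simpa using List.toFinset_card_of_nodup hnd
  have heq := Set.eq_of_subset_of_ncard_le hsub (by rw [Set.ncard_coe_finset, hcard]; exact h)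
  ext x y
  simp only [sup_adj, edge_adj]
  constructor
  · intro hxy
    have hx : x ∈ (({a, b, c, d} : Finset V) : Set V) := heq ▸ hxy.mem_support_left
    simp only [Finset.coe_insert, Finset.coe_singleton, Set.mem_insert_iff,
      Set.mem_singleton_iff] at hx
    rcases hx with rfl | rfl | rfl | rfl
    · exact .inl ⟨.inl ⟨rfl, hM hxy hab⟩, hxy.ne⟩
    · exact .inl ⟨.inr ⟨rfl, hM hxy hab.symm⟩, hxy.ne⟩
    · exact .inr ⟨.inl ⟨rfl, hM hxy hcd⟩, hxy.ne⟩
    · exact .inr ⟨.inr ⟨rfl, hM hxy hcd.symm⟩, hxy.ne⟩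
  · rintro (⟨⟨rfl, rfl⟩ | ⟨rfl, rfl⟩, -⟩ | ⟨⟨rfl, rfl⟩ | ⟨rfl, rfl⟩, -⟩)
    exacts [hab, hab.symm, hcd, hcd.symm]

end SmallMatchings

/-! ### Dimensions two and three -/

section SmallDimensions

/-- Two disjoint edges on the four vertices of `Q_2` are completed to a 4-cycle by cube edges. -/
theorem hypercube_two_adj_cases : ∀ a b c d : Fin 2 → Bool, [a, b, c, d].Nodup →
    (hammingDist b c = 1 ∧ hammingDist d a = 1) ∨ (hammingDist b d = 1 ∧ hammingDist c a = 1) := by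
  decide +kernel

/-- A pair of vertices of `Q_2` is antipodal and then has a common neighbour, or else is disjoint
from a cube edge. -/
theorem hypercube_two_edge_cases : ∀ a b : Fin 2 → Bool, a ≠ b →
    (∃ x, hammingDist b x = 1 ∧ hammingDist x a = 1) ∨
      ∃ c d, hammingDist c d = 1 ∧ [a, b, c, d].Nodup := by
  decide +kernel

theorem extendsUpTo_two : ExtendsUpTo 2 4 := by
  have hcard : Nat.card (Fin 2 → Bool) = 4 := by simp
  have htwo : ∀ a b c d : Fin 2 → Bool, [a, b, c, d].Nodup →
      ExtendsToLongCycle (hypercube 2) (edge a b ⊔ edge c d) := by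
    have key : ∀ a b c d : Fin 2 → Bool, [a, b, c, d].Nodup → hammingDist b c = 1 →
        hammingDist d a = 1 → ExtendsToLongCycle (hypercube 2) (edge a b ⊔ edge c d) := by
      intro a b c d hnd h1 h2
      have hne : a ≠ b ∧ c ≠ d := by simp at hnd; tauto
      refine extendsToLongCycle_of_cyclic_sequence (k := 1) ![a, b, c, d] ?_ ?_ ?_ ?_
      · exact List.nodup_ofFn.1 (by simpa using hnd)
      · intro x y hxy
        simp only [sup_adj, edge_adj] at hxy
        rcases hxy with ⟨⟨rfl, rfl⟩ | ⟨rfl, rfl⟩, -⟩ | ⟨⟨rfl, rfl⟩ | ⟨rfl, rfl⟩, -⟩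
        · exact ⟨0, .inl ⟨rfl, rfl⟩⟩
        · exact ⟨0, .inr ⟨rfl, rfl⟩⟩
        · exact ⟨2, .inl ⟨rfl, rfl⟩⟩
        · exact ⟨2, .inr ⟨rfl, rfl⟩⟩
      · intro i
        simp only [sup_adj, edge_adj]
        fin_cases i
        · exact .inl (.inl ⟨.inl ⟨rfl, rfl⟩, hne.1⟩)
        · exact .inr h1
        · exact .inl (.inr ⟨.inl ⟨rfl, rfl⟩, hne.2⟩)
        · exact .inr h2
      · lia
    intro a b c d hnd
    rcases hypercube_two_adj_cases a b c d hnd with h | h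
    · exact key a b c d hnd h.1 h.2
    · rw [edge_comm c d]
      refine key a b d c ?_ h.1 h.2
      simp at hnd ⊢
      tauto
  have hone : ∀ a b : Fin 2 → Bool, a ≠ b → ExtendsToLongCycle (hypercube 2) (edge a b) := by
    intro a b hab
    rcases hypercube_two_edge_cases a b hab with ⟨x, h1, h2⟩ | ⟨c, d, hcd, hnd⟩
    · have hbx : b ≠ x := by rintro rfl; simp at h1
      have hxa : x ≠ a := by rintro rfl; simp at h2
      refine extendsToLongCycle_of_cyclic_sequence (k := 0) ![a, b, x] ?_ ?_ ?_ ?_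
      · exact List.nodup_ofFn.1 (by simp [hab, hbx, hxa.symm])
      · intro u v huv
        rw [edge_adj] at huv
        rcases huv with ⟨⟨rfl, rfl⟩ | ⟨rfl, rfl⟩, -⟩
        · exact ⟨0, .inl ⟨rfl, rfl⟩⟩
        · exact ⟨0, .inr ⟨rfl, rfl⟩⟩
      · intro i
        simp only [edge_adj]
        fin_cases i
        · exact .inl ⟨.inl ⟨rfl, rfl⟩, hab⟩
        · exact .inr h1
        · exact .inr h2
      · lia
    · exact .of_sup_edge hcd (htwo a b c d hnd)
  intro M hM hm
  rcases hM.eq_of_ncard_support_le_four hm with rfl | ⟨a, b, hab, rfl⟩ | ⟨a, b, c, d, hnd, rfl⟩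
  · refine .of_sup_edge (x := ![false, false]) (y := ![true, false]) ?_ ?_
    · change hammingDist _ _ = 1
      decide
    · rw [bot_sup_eq]
      exact hone _ _ (by decide)
  · exact hone a b hab
  · exact htwo a b c d hnd

set_option synthInstance.maxHeartbeats 200000 in
set_option synthInstance.maxSize 2000 in
theorem hypercube_three_cases : ∀ a b c d : Fin 3 → Bool, [a, b, c, d].Nodup →
    ∃ i, (a i ≠ b i ∨ c i ≠ d i) ∧ ((a i ^^ b i ^^ c i ^^ d i) = false ∨
      ∃ u ∈ [a, b, c, d], ∃ v ∈ [a, b, c, d], u i ≠ v i ∧ ∀ j, j ≠ i → u j = v j) := by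
  decide +kernel

/-- For two edges in `Q_3`, `hypercube_three_cases` says that there is a direction crossed by an edge in which either both facets
contain two of the four matched vertices, or two matched vertices are adjacent. In the latter
case the projections of the matched vertices do not cover `Q_2`, so that an edge in this
direction can be added where needed. -/
theorem extendsUpTo_three : ExtendsUpTo 3 4 := by
  classical
  intro M hM hm
  rcases hM.eq_of_ncard_support_le_four hm with rfl | ⟨a, b, hab, rfl⟩ | ⟨a, b, c, d, hnd, rfl⟩
  · have h0 : ∀ b, facetCount (⊥ : SimpleGraph (Fin 3 → Bool)).support 0 b = 0 := by
      intro b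
      simp [facetCount]
    exact extendsUpTo_two.extends_of_facetCount (by decide) hM 0 false (by rw [h0]; lia)
      (by rw [h0]; lia) (by rw [h0]; simp) (.inr (by rw [h0, h0]; lia))
  · have hs : (edge a b).support.ncard = 2 := by rw [support_edge hab, Set.ncard_pair hab]
    obtain ⟨i, hi⟩ := Function.ne_iff.1 hab
    have := facetCount_add (edge a b).support i false
    exact extendsUpTo_two.extends_of_facetCount (by decide) hM i false (by lia) (by lia)
      (fun _ => exists_notMem_preimage_facet (by rw [hs]; decide) i _)
      (.inl (exists_crossing_facet ((edge_adj ..).2 ⟨.inl ⟨rfl, rfl⟩, hab⟩) hi _))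
  · have hab : a ≠ b := by simp at hnd; tauto
    have hcd : c ≠ d := by simp at hnd; tauto
    set M := edge a b ⊔ edge c d with hMdef
    have hs : M.support = (([a, b, c, d].toFinset : Finset (Fin 3 → Bool)) : Set _) := by
      rw [hMdef, support_sup, support_edge hab, support_edge hcd]
      ext x
      simp
      tauto
    have hs4 : M.support.ncard = 4 := by
      rw [hs, Set.ncard_coe_finset, List.toFinset_card_of_nodup hnd]
      rfl
    obtain ⟨i, hi, hor⟩ := hypercube_three_cases a b c d hnd
    have hadd := facetCount_add M.support i false
    have hcross : ∃ x x', M.Adj (facet i false x) (facet i (!false) x') := by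
      rcases hi with hi | hi
      · exact exists_crossing_facet (M := M) (Or.inl ((edge_adj ..).2 ⟨.inl ⟨rfl, rfl⟩, hab⟩)) hi _
      · exact exists_crossing_facet (M := M) (Or.inr ((edge_adj ..).2 ⟨.inl ⟨rfl, rfl⟩, hcd⟩)) hi _
    refine extendsUpTo_two.extends_of_facetCount (by decide) hM i false (by lia) (by lia) ?_
      (.inl hcross)
    intro hodd
    rcases hor with hx | ⟨u, hu, v, hv, huv, hoff⟩
    · exfalso
      have hcount : facetCount M.support i false =
          ([a, b, c, d].filter fun x => x i = false).length := by
        rw [facetCount_eq, hs, ← List.toFinset_card_of_nodup (hnd.filter _),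
          ← Set.ncard_coe_finset]
        congr 1
        ext x
        simp
      rw [hcount] at hodd
      revert hx hodd
      cases ha : a i <;> cases hb : b i <;> cases hc : c i <;> cases hd : d i <;>
        simp [ha, hb, hc, hd] <;> decide
    · by_contra! hall
      have huS : u ∈ M.support := by rw [hs]; simpa using hu
      have hvS : v ∈ M.support := by rw [hs]; simpa using hv
      -- the common projection of `u` and `v` lies in the preimages of both facets
      obtain ⟨p, hp, hp'⟩ : ∃ p, facet i false p ∈ M.support ∧ facet i (!false) p ∈ M.support := by
        have hpr : ∀ b, v i = !b → u i = b → ∃ p, facet i b p = u ∧ facet i (!b) p = v := by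
          intro b hvb hub
          obtain ⟨p, rfl⟩ := exists_facet_eq hub
          refine ⟨p, rfl, ?_⟩
          ext j
          by_cases hj : j = i
          · subst hj
            rw [facet_apply_same, hvb]
          · rw [← hoff j hj]
            obtain ⟨k, rfl⟩ := Fin.exists_succAbove_eq hj
            simp [facet]
        cases hub : u i
        · obtain ⟨p, hp, hp'⟩ := hpr false (by revert huv; rw [hub]; cases v i <;> simp) hub
          exact ⟨p, hp ▸ huS, hp' ▸ hvS⟩
        · obtain ⟨p, hp, hp'⟩ := hpr true (by revert huv; rw [hub]; cases v i <;> simp) hub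
          exact ⟨p, hp' ▸ hvS, hp ▸ huS⟩
      have hinter : 0 < (facet i false ⁻¹' M.support ∩ facet i (!false) ⁻¹' M.support).ncard :=
        (Set.ncard_pos).2 ⟨p, hp, hp'⟩
      have hunion : facet i false ⁻¹' M.support ∪ facet i (!false) ⁻¹' M.support = Set.univ :=
        Set.eq_univ_of_forall fun x => by
          by_cases h : x ∈ facet i false ⁻¹' M.support
          · exact .inl h
          · exact .inr (hall x h)
      have hcard := Set.ncard_union_add_ncard_inter (facet i false ⁻¹' M.support)
        (facet i (!false) ⁻¹' M.support)
      rw [hunion, Set.ncard_univ] at hcard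
      have h4 : Nat.card (Fin 2 → Bool) = 4 := by simp
      unfold facetCount at hadd
      lia

end SmallDimensions

/-! ### Dimensions four and above -/

section Dimensions

theorem facetCount_insert_same {n : ℕ} {T : Set (Fin (n + 1) → Bool)} {x : Fin (n + 1) → Bool}
    (hx : x ∉ T) (d : Fin (n + 1)) : facetCount (insert x T) d (x d) = facetCount T d (x d) + 1 := by
  rw [facetCount_eq, facetCount_eq, ← Set.ncard_insert_of_notMem (a := x) (fun h => hx h.1)]
  congr 1
  ext y
  simp only [Set.mem_insert_iff, Set.mem_ofPred_eq]
  constructor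
  · rintro ⟨rfl | h, h'⟩
    · exact .inl rfl
    · exact .inr ⟨h, h'⟩
  · rintro (rfl | h)
    · exact ⟨.inl rfl, rfl⟩
    · exact ⟨.inr h.1, h.2⟩

/-- Three edges in `Q_4`. Suppose that every direction crossed by an edge has a facet with at most one
matched vertex, and for each direction let `m` be the minority count and `K` the number of
matched vertices whose edge crosses it. Then `2m + K ≤ 4`: without crossing edges `m` is even and at
most `3`, and otherwise `K ≤ 2m` and `m ≤ 1`. The sum over the four directions contradicts
`exists_majority`, as every edge crosses some direction. -/
theorem exists_crossing_two_le_facetCount {M : SimpleGraph (Fin 4 → Bool)}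
    (hM : IsMatchingGraph M) (h6 : M.support.ncard = 6) :
    ∃ d b, (∃ u v, M.Adj u v ∧ u d ≠ v d) ∧ facetCount M.support d (!b) ≤ facetCount M.support d b ∧
      2 ≤ facetCount M.support d (!b) := by
  classical
  obtain ⟨w, hw, hsum⟩ := exists_majority M.support
  by_contra! hcon
  have hcon' : ∀ d, (∃ u v, M.Adj u v ∧ u d ≠ v d) → facetCount M.support d (!w d) ≤ 1 :=
    fun d hd => Nat.le_of_lt_succ (hcon d (w d) hd (hw d))
  have hmate : ∀ v, ∃ v', v ∈ M.support → M.Adj v v' := by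
    intro v
    by_cases hv : v ∈ M.support
    · obtain ⟨v', h⟩ := hv
      exact ⟨v', fun _ => h⟩
    · exact ⟨v, fun h => absurd h hv⟩
  choose μ hμ using hmate
  let S := M.support.toFinset
  have hS : ∀ {v}, v ∈ S ↔ v ∈ M.support := by simp [S]
  have hScard : S.card = 6 := by rw [← h6, Set.ncard_eq_toFinset_card']
  have hcount : ∀ d b, facetCount M.support d b = (S.filter fun v => v d = b).card := by
    intro d b
    rw [facetCount_eq, ← Set.ncard_coe_finset]
    congr 1
    ext v
    simp [hS]
  let K : Fin 4 → ℕ := fun d => (S.filter fun v => v d ≠ μ v d).card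
  have hK : 6 ≤ ∑ d, K d := by
    have : ∑ d, K d = ∑ v ∈ S, hammingDist v (μ v) := by
      simp only [K, hammingDist, Finset.card_filter]
      rw [Finset.sum_comm]
    rw [this]
    calc 6 = ∑ v ∈ S, 1 := by simp [hScard]
      _ ≤ _ := Finset.sum_le_sum fun v hv =>
        Nat.one_le_iff_ne_zero.2 (hammingDist_ne_zero.2 (hμ v (hS.1 hv)).ne)
  have hd : ∀ d, 2 * facetCount M.support d (!w d) + K d ≤ 4 := by
    intro d
    by_cases hc : ∃ u v, M.Adj u v ∧ u d ≠ v d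
    · have h1 := hcon' d hc
      have h2 : K d ≤ (S.filter fun v => v d = !w d).card +
          (S.filter fun v => v d = !w d).card := by
        rw [show K d = _ from (Finset.card_filter_add_card_filter_not
          (s := S.filter fun v => v d ≠ μ v d) (fun v => v d = !w d)).symm]
        refine add_le_add (Finset.card_le_card ?_) (Finset.card_le_card_of_injOn μ ?_ ?_)
        · intro v hv
          simp only [Finset.mem_filter] at hv ⊢
          exact ⟨hv.1.1, hv.2⟩
        · intro v hv
          simp only [Finset.coe_filter, Finset.mem_filter, Set.mem_ofPred_eq] at hv ⊢
          refine ⟨hS.2 (hμ v (hS.1 hv.1.1)).mem_support_right, ?_⟩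
          have h1 := hv.1.2
          have h2 := hv.2
          revert h1 h2
          cases v d <;> cases μ v d <;> cases w d <;> simp
        · intro v hv v' hv' h
          simp only [Finset.coe_filter, Finset.mem_filter, Set.mem_ofPred_eq] at hv hv'
          exact hM (hμ v (hS.1 hv.1.1)).symm (h ▸ (hμ v' (hS.1 hv'.1.1)).symm)
      rw [← hcount] at h2
      lia
    · push Not at hc
      have h1 : K d = 0 := by
        simp only [K, Finset.card_eq_zero, Finset.filter_eq_empty_iff, not_not]
        exact fun v hv => hc v (μ v) (hμ v (hS.1 hv))
      have h2 : Even (facetCount M.support d (!w d)) := by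
        have hpre : facet d (!w d) ⁻¹' M.support = (M.comap (facet d (!w d))).support := by
          rw [(isDoubling_facet d).preimage_support, Set.union_eq_left]
          rintro a ⟨a', ha'⟩
          have := hc _ _ ha'
          rw [facet_apply_same, facet_apply_same] at this
          simp at this
        rw [facetCount, hpre]
        exact (hM.comap _).even_ncard_support
      have h3 := facetCount_add M.support d (w d)
      have h4 := hw d
      grind
  have htot := Finset.sum_le_sum fun d (_ : d ∈ Finset.univ) => hd d
  rw [Finset.sum_add_distrib, ← Finset.mul_sum] at htot
  simp only [Finset.sum_const, Finset.card_univ, Fintype.card_fin, smul_eq_mul] at htot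
  lia

theorem extendsUpTo_four : ExtendsUpTo 4 6 := by
  intro M hM hm
  obtain ⟨k, hk⟩ := hM.even_ncard_support
  by_cases h6 : M.support.ncard = 6
  · obtain ⟨d, b, ⟨u, v, huv, hd⟩, hle, h2⟩ := exists_crossing_two_le_facetCount hM h6
    have hadd := facetCount_add M.support d b
    exact extendsUpTo_three.extends_of_facetCount (by decide) hM d b (by lia) (by lia)
      (fun _ => exists_notMem_preimage_facet (by lia) d _)
      (.inl (exists_crossing_facet huv hd _))
  · by_cases hbot : M = ⊥
    · have h0 : ∀ b, facetCount M.support 0 b = 0 := by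
        intro b
        simp [facetCount, hbot]
      exact extendsUpTo_three.extends_of_facetCount (by decide) hM 0 false (by rw [h0]; lia)
        (by rw [h0]; lia) (by rw [h0]; simp) (.inr (by rw [h0, h0]; lia))
    · obtain ⟨u, v, huv⟩ := ne_bot_iff_exists_adj.1 hbot
      obtain ⟨d, hd⟩ := Function.ne_iff.1 huv.ne
      have hadd := facetCount_add M.support d false
      exact extendsUpTo_three.extends_of_facetCount (by decide) hM d false (by lia) (by lia)
        (fun _ => exists_notMem_preimage_facet (by lia) d _)
        (.inl (exists_crossing_facet huv hd _))

theorem extendsUpTo_five : ExtendsUpTo 5 8 :=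
  extendsUpTo_four.step (t := 2) (by decide) (by lia) (by lia) (by lia)

/-- If no direction leaves at most eight of the twelve vertices in each facet, some direction
splits them as `9 + 3`. An auxiliary edge `x x'` across this direction is then placed such that the
ten vertices of the larger side split as `4 + 6` within `Q_5`. -/
theorem extendsUpTo_six : ExtendsUpTo 6 12 := by
  intro M hM hm
  obtain ⟨k, hk⟩ := hM.even_ncard_support
  by_cases h10 : M.support.ncard ≤ 10
  · exact extendsUpTo_five.step (t := 2) (by decide) (by lia) (by lia) (by lia) M hM h10
  have h12 : M.support.ncard = 12 := by lia
  obtain ⟨w, hw, hsum⟩ := exists_majority M.support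
  obtain ⟨d, hd⟩ : ∃ d, 3 ≤ facetCount M.support d (!w d) := by
    by_contra! hcon
    have := Finset.sum_le_card_nsmul Finset.univ _ 2 fun d _ => Nat.le_of_lt_succ (hcon d)
    simp at this
    lia
  have hadd := facetCount_add M.support d (w d)
  have hwd := hw d
  by_cases h4 : 4 ≤ facetCount M.support d (!w d)
  · exact extendsUpTo_five.extends_of_facetCount (by decide) hM d (w d) (by lia) (by lia)
      (fun _ => exists_notMem_preimage_facet (by lia) d _) (.inr ⟨by lia, by lia⟩)
  have h3 : facetCount M.support d (!w d) = 3 := by lia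
  have h9 : facetCount M.support d (w d) = 9 := by lia
  set T := facet d (w d) ⁻¹' M.support with hT
  have hT9 : T.ncard = 9 := h9
  obtain ⟨z, hz, hzsum⟩ := exists_majority T
  obtain ⟨e, he⟩ : ∃ e, 3 ≤ facetCount T e (!z e) := by
    by_contra! hcon
    have := Finset.sum_le_card_nsmul Finset.univ _ 2 fun e _ => Nat.le_of_lt_succ (hcon e)
    simp at this
    lia
  have hze := hz e
  have hadde := facetCount_add T e (z e)
  -- `β` is the facet of `Q_5` with an odd number of vertices of `T`
  obtain ⟨β, hβ⟩ : ∃ β, (facetCount T e β = 3 ∧ facetCount T e (!β) = 6) ∨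
      (facetCount T e β = 5 ∧ facetCount T e (!β) = 4) := by
    by_cases h : facetCount T e (!z e) = 3
    · refine ⟨!z e, .inl ⟨h, ?_⟩⟩
      rw [Bool.not_not]
      lia
    · exact ⟨z e, .inr ⟨by lia, by lia⟩⟩
  obtain ⟨y, hy⟩ : ∃ y, y ∉ facet e β ⁻¹' T ∪ facet e β ⁻¹' (facet d (!w d) ⁻¹' M.support) := by
    by_contra! hall
    have h1 := Set.ncard_union_le (facet e β ⁻¹' T)
      (facet e β ⁻¹' (facet d (!w d) ⁻¹' M.support))
    have h2 := facetCount_add (facet d (!w d) ⁻¹' M.support) e β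
    have h3' : (facet d (!w d) ⁻¹' M.support).ncard = 3 := h3
    have h16 : Nat.card (Fin 4 → Bool) = 16 := by simp
    rw [Set.eq_univ_of_forall hall, Set.ncard_univ, h16] at h1
    unfold facetCount at h2 hβ
    lia
  rw [Set.mem_union, not_or] at hy
  have hyβ : facet e β y e = β := facet_apply_same e β y
  have hins : facetCount (insert (facet e β y) T) e β = facetCount T e β + 1 := by
    have := facetCount_insert_same (x := facet e β y) (T := T) hy.1 e
    rwa [hyβ] at this
  have hins' := facetCount_add (insert (facet e β y) T) e β
  have hcard : (insert (facet e β y) T).ncard = 10 := by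
    rw [Set.ncard_insert_of_notMem (show facet e β y ∉ T from hy.1), hT9]
  refine (isDoubling_facet d).extends_of_odd hM (w d) (x := facet e β y) ?_ hy.1 hy.2 ?_ ?_
  · rw [← hT, hT9]
    decide
  · rw [← hT]
    intro N hN hNs
    rw [← hNs] at hins hins' hcard
    have hsmall : ∀ b, facetCount N.support e b = 6 ∧ facetCount N.support e (!b) = 4 →
        ExtendsToLongCycle (hypercube 5) N := fun b hb =>
      extendsUpTo_four.extends_of_facetCount (by decide) hN e b (by lia) (by lia)
        (fun _ => exists_notMem_preimage_facet (by lia) e _) (.inr ⟨by lia, by lia⟩)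
    rcases hβ with hβ | hβ
    · refine hsmall (!β) ?_
      rw [Bool.not_not]
      lia
    · exact hsmall β (by lia)
  · refine extendsUpTo_five.isExtendableSet ?_
    rw [Set.ncard_insert_of_notMem (show facet e β y ∉ facet d (!w d) ⁻¹' M.support from hy.2)]
    change facetCount M.support d (!w d) + 1 ≤ 8
    lia

theorem mul_lt_pow_sixtyfour (j : ℕ) : 30 * ((j + 2) * (j + 3)) < 3 * 64 ^ (j + 1) := by
  induction j with
  | zero => norm_num
  | succ j ih => rw [pow_succ]; nlinarith

/-- From dimension `6` on, the number of vertices that can be allowed grows by `2(j + 1)` when passing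
from dimension `6j + s`, `0 ≤ s < 6`, to the next one. -/
theorem extendsUpTo_of_six_le {n : ℕ} (hn : 6 ≤ n) :
    ExtendsUpTo n ((n / 6 + 1) * (6 * (n / 6) + 2 * (n % 6))) := by
  induction n, hn using Nat.le_induction with
  | base => exact extendsUpTo_six
  | succ n hn ih =>
    obtain ⟨j, hj⟩ : ∃ j, n / 6 = j + 1 := Nat.exists_eq_succ_of_ne_zero (by lia)
    obtain ⟨s, hs⟩ : ∃ s, n % 6 = s := ⟨_, rfl⟩
    have hns : n = 6 * (j + 1) + s := by lia
    have hs6 : s < 6 := by lia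
    rw [hj, hs] at ih
    have hnext : ((n + 1) / 6 + 1) * (6 * ((n + 1) / 6) + 2 * ((n + 1) % 6)) =
        (j + 1 + 1) * (6 * (j + 1) + 2 * s) + 2 * (j + 2) := by
      rcases Nat.lt_or_ge s 5 with h | h
      · have h1 : (n + 1) / 6 = j + 1 := by lia
        have h2 : (n + 1) % 6 = s + 1 := by lia
        rw [h1, h2]
        ring
      · have h1 : (n + 1) / 6 = j + 2 := by lia
        have h2 : (n + 1) % 6 = 0 := by lia
        obtain rfl : s = 5 := by lia
        rw [h1, h2]
        ring
    rw [hnext]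
    refine ih.step ⟨(j + 2) * (3 * (j + 1) + s), by ring⟩ ?_ ?_ ?_
    · rw [hns]
      nlinarith
    · nlinarith
    · have hpow : 64 ^ (j + 1) ≤ 2 ^ n := by
        rw [show (64 : ℕ) = 2 ^ 6 by norm_num, ← pow_mul]
        exact Nat.pow_le_pow_right (by norm_num) (by lia)
      have := mul_lt_pow_sixtyfour j
      have h5 : (j + 2) * s ≤ (j + 2) * 5 := Nat.mul_le_mul_left _ (by lia)
      nlinarith

/-- The hypothesis is `m < n ^ 2 / 6 + n / 2 + 1` with cleared denominators. -/
theorem extendsUpTo_of_lt {n m : ℕ} (hn : 2 ≤ n) (hm : 6 * m < n ^ 2 + 3 * n + 6) :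
    ExtendsUpTo n m := by
  rcases Nat.lt_or_ge n 6 with h | h
  · interval_cases n
    · exact extendsUpTo_two.mono (by lia)
    · exact extendsUpTo_three.mono (by lia)
    · exact extendsUpTo_four.mono (by lia)
    · exact extendsUpTo_five.mono (by lia)
  · refine (extendsUpTo_of_six_le h).mono ?_
    obtain ⟨j, hj⟩ : ∃ j, n / 6 = j + 1 := Nat.exists_eq_succ_of_ne_zero (by lia)
    obtain ⟨s, hs⟩ : ∃ s, n % 6 = s := ⟨_, rfl⟩
    have hns : n = 6 * (j + 1) + s := by lia
    have hs6 : s < 6 := by lia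
    rw [hj, hs]
    rw [hns] at hm
    have : s * s ≤ 5 * s := Nat.mul_le_mul_right _ (by lia)
    nlinarith

end Dimensions

/-! ### From cycle graphs to closed walks -/

/-- A graph consisting of a single cycle is traced out by a closed walk in any larger graph. -/
theorem IsCycleGraph.exists_walk {V : Type*} [Finite V] {C G : SimpleGraph V}
    (hC : IsCycleGraph C) (hle : C ≤ G) :
    ∃ (v : V) (p : G.Walk v v), p.IsCycle ∧ p.edgeSet = C.edgeSet ∧
      p.length = C.support.ncard := by
  classical
  have := Fintype.ofFinite V
  obtain ⟨v, w, hvw⟩ := hC.nonempty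
  have hcyc : C.IsCycles := by
    intro x hx
    obtain ⟨a, b, hab, h⟩ := hC.two_nbrs x hx
    rw [Set.ncard_eq_two]
    refine ⟨a, b, hab, ?_⟩
    ext y
    simp [h]
  obtain ⟨p, hp, hverts⟩ := hcyc.exists_cycle_toSubgraph_verts_eq_connectedComponentSupp
    (c := C.connectedComponentMk v) rfl ⟨w, hvw⟩
  have hsupp : ∀ x, x ∈ p.support ↔ x ∈ C.support := by
    intro x
    rw [← Walk.mem_verts_toSubgraph, hverts]
    constructor
    · intro hx
      by_cases hxv : x = v
      · exact hxv ▸ hvw.mem_support_left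
      · obtain ⟨q⟩ := ConnectedComponent.exact hx
        cases q with
        | nil => exact absurd rfl hxv
        | cons h _ => exact h.mem_support_left
    · intro hx
      exact ConnectedComponent.sound (hC.reachable x hx v hvw.mem_support_left)
  refine ⟨v, p.mapLe hle, hp.mapLe hle, ?_, ?_⟩
  · ext e
    simp only [Walk.edgeSet, Walk.edges_mapLe_eq_edges, Set.mem_ofPred_eq]
    induction e with
    | _ x y =>
      rw [mem_edgeSet]
      constructor
      · exact fun h => p.adj_of_mem_edges h
      · intro h
        rw [← Walk.adj_toSubgraph_iff_mem_edges]
        exact (hp.adj_toSubgraph_iff_of_isCycles hcyc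
          ((Walk.mem_verts_toSubgraph p).2 ((hsupp x).2 h.mem_support_left)) y).2 h
  · rw [Walk.length_map]
    have h1 : C.support = (p.support.tail.toFinset : Set V) := by
      ext x
      rw [← hsupp x, List.coe_toFinset, Set.mem_ofPred_eq]
      refine ⟨fun hx => ?_, List.mem_of_mem_tail⟩
      rw [Walk.mem_support_iff] at hx
      rcases hx with rfl | hx
      · exact Walk.end_mem_tail_support hp.not_nil
      · exact hx
    rw [h1, Set.ncard_coe_finset, List.toFinset_card_of_nodup hp.support_nodup]
    simp

theorem mainTheorem2 (n : ℕ) (hn : 2 ≤ n)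
    (M : (hypercubeComplete n).Subgraph) (hM : M.IsMatching)
    (hcard : (M.verts.ncard : ℝ) < (n : ℝ) ^ 2 / 6 + (n : ℝ) / 2 + 1) :
    ∃ S : Set (Sym2 (Fin n → Bool)), S ⊆ (hypercube n).edgeSet ∧
      ∃ (v : Fin n → Bool) (C : (hypercubeComplete n).Walk v v),
        C.IsCycle ∧ C.edgeSet = M.edgeSet ∪ S ∧
          (3 / 4 : ℝ) * (Fintype.card (Fin n → Bool) : ℝ) ≤ (C.length : ℝ) := by
  have hm : 6 * M.verts.ncard < n ^ 2 + 3 * n + 6 := by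
    have : (6 : ℝ) * M.verts.ncard < (n : ℝ) ^ 2 + 3 * n + 6 := by linarith
    exact_mod_cast this
  have hmatch : IsMatchingGraph M.spanningCoe := fun a b c hb hc =>
    (hM (M.edge_vert hb)).unique hb hc
  have hsupp : M.spanningCoe.support = M.verts := by
    ext v
    exact ⟨fun ⟨w, hw⟩ => M.edge_vert hw, fun hv => (hM hv).exists⟩
  obtain ⟨C, hC, hMC, hCM, hlen⟩ := extendsUpTo_of_lt hn hm M.spanningCoe hmatch (by rw [hsupp])
  obtain ⟨v, p, hp, hedge, hplen⟩ := hC.exists_walk (le_top (a := C))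
  refine ⟨C.edgeSet \ M.edgeSet, ?_, v, p, hp, ?_, ?_⟩
  · intro e
    induction e with
    | _ x y =>
      rintro ⟨h1, h2⟩
      exact (hCM h1).resolve_left h2
  · have hsub : M.edgeSet ⊆ C.edgeSet := by
      intro e
      induction e with
      | _ x y => exact fun h => hMC h
    rw [hedge, Set.union_sdiff_cancel hsub]
  · rw [hplen, ← Nat.card_eq_fintype_card]
    have : (3 : ℝ) * (Nat.card (Fin n → Bool) : ℝ) ≤ 4 * (C.support.ncard : ℝ) := by
      exact_mod_cast hlen
    linarith
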